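/- Let $(N^3(c),h)$ be a three-dimensional smooth Riemannian manifold of constant sectional curvature $c\in\mathbb R$, with Levi-Civita connection $\nabla$ and curvature tensor $R(X,Y)Z=\nabla_X\nabla_YZ-\nabla_Y\nabla_XZ-\nabla_{[X,Y]}Z$, and let $p,q>1$ be real numbers. Let $I\subseteq\mathbb R$ be a nonempty open interval and $\gamma:I\to N^3(c)$ a smooth curve parametrized by arc length, $T=\gamma'$. Write $\nabla_T$ for the covariant derivative along $\gamma$. The $p$-tension field of $\gamma$ is $\tau_p(\gamma)=\nabla_T\big(|\gamma'|^{p-2}\gamma'\big)$ and, with $V=|\tau_p(\gamma)|^{q-2}\tau_p(\gamma)$, its $(p,q)$-tension field is $$\tau_{p,q}(\gamma)=-|\gamma'|^{p-2}|\tau_p(\gamma)|^{q-2}R\big(\tau_p(\gamma),\gamma'\big)\gamma'-\nabla_T\big(|\gamma'|^{p-2}\nabla_TV\big)-(p-2)\nabla_T\big(|\gamma'|^{p-4}h(\nabla_TV,\gamma')\gamma'\big).$$ (At zeros of $\tau_p(\gamma)$, the field $V$ and the curvature term are taken to be $0$.) The curve $\gamma$ is called proper $(p,q)$-harmonic if $\tau_{p,q}(\gamma)$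 is defined and vanishes on $I$ and $\gamma$ is not $p$-harmonic, that is, $\tau_p(\gamma)$ does not vanish identically on $I$. **Theorem.** The curve $\gamma$ is proper $(p,q)$-harmonic if and only if its geodesic curvature $k$ and geodesic torsion $\tau$ are constant with $k>0$, that is, there are constants $k>0$ and $\tau$ and a smooth orthonormal frame field $\{T,N,B\}$ along $\gamma$ with $$\nabla_TT=kN,\qquad \nabla_TN=-kT+\tau B,\qquad \nabla_TB=-\tau N,$$ and $$p=\frac{c-\tau^2}{k^2}+1 .$$ -/

import Mathlib

open Bundle Set
open scoped Manifold ContDiff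

noncomputable section

section Curves

variable {E : Type*} [NormedAddCommGroup E] [NormedSpace ℝ E]
  {M : Type*} [TopologicalSpace M] [ChartedSpace E M]

/-- The velocity `dγ(d/dt)` of a curve. -/
def velocity (γ : ℝ → M) (t : ℝ) : TangentSpace 𝓘(ℝ, E) (γ t) :=
  mfderiv 𝓘(ℝ, ℝ) 𝓘(ℝ, E) γ t (1 : ℝ)

variable [IsManifold 𝓘(ℝ, E) ∞ M]

/-- The vector field `V` along the curve `γ` is differentiable at `t`. -/
def DiffAlongAt {γ : ℝ → M} (V : ∀ t, TangentSpace 𝓘(ℝ, E) (γ t)) (t : ℝ) : Prop :=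
  MDifferentiableAt 𝓘(ℝ, ℝ) 𝓘(ℝ, E).tangent
    (fun r => (⟨γ r, V r⟩ : TangentBundle 𝓘(ℝ, E) M)) t

/-- The vector field `V` along the curve `γ` is smooth on `s`. -/
def SmoothAlongOn {γ : ℝ → M} (V : ∀ t, TangentSpace 𝓘(ℝ, E) (γ t)) (s : Set ℝ) : Prop :=
  ContMDiffOn 𝓘(ℝ, ℝ) 𝓘(ℝ, E).tangent ∞
    (fun r => (⟨γ r, V r⟩ : TangentBundle 𝓘(ℝ, E) M)) s

variable (D : CovariantDerivative 𝓘(ℝ, E) E (TangentSpace 𝓘(ℝ, E) : M → Type _))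

/-- The Riemann curvature tensor
`R(u, v) w = D_u D_v w - D_v D_u w - D_[u, v] w` at the point `x`. Being tensorial, it may be
computed on any smooth local extensions of the tangent vectors `u, v, w`; `FiberBundle.extend`
extends a vector by constant components in a local trivialization. -/
def curvatureTensor (x : M) (u v w : TangentSpace 𝓘(ℝ, E) x) : TangentSpace 𝓘(ℝ, E) x :=
  let U : ∀ y : M, TangentSpace 𝓘(ℝ, E) y := FiberBundle.extend E u
  let V : ∀ y : M, TangentSpace 𝓘(ℝ, E) y := FiberBundle.extend E v
  let W : ∀ y : M, TangentSpace 𝓘(ℝ, E) y := FiberBundle.extend E w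
  D (fun y => D W y (V y)) x (U x) - D (fun y => D W y (U y)) x (V x)
    - D W x (VectorField.mlieBracket 𝓘(ℝ, E) U V x)

/-- The covariant derivative `D_{d/dt} V` of a vector field `V` along the curve `γ`, that is, the
connection `D` pulled back to `γ`. If `(E_i)` is the frame of a local trivialization of the tangent
bundle around `γ t` and `V = ∑ v_i (E_i ∘ γ)`, it equals `∑ v_i' E_i + ∑ v_i D_{γ'} E_i` at `t`.
The first sum is the first summand below; the second is `D_{γ'} (∑ v_i(t) E_i)`, where
`∑ v_i(t) E_i = FiberBundle.extend E (V t)`. -/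
def covDerivAlong (γ : ℝ → M) (V : ∀ t, TangentSpace 𝓘(ℝ, E) (γ t)) (t : ℝ) :
    TangentSpace 𝓘(ℝ, E) (γ t) :=
  (trivializationAt E (TangentSpace 𝓘(ℝ, E)) (γ t)).symm (γ t)
      (deriv (fun r =>
        (trivializationAt E (TangentSpace 𝓘(ℝ, E)) (γ t)
          (⟨γ r, V r⟩ : TangentBundle 𝓘(ℝ, E) M)).2) t)
    + D (FiberBundle.extend E (V t)) (γ t) (velocity γ t)

end Curves

section Riemannian

variable {E : Type*} [NormedAddCommGroup E] [NormedSpace ℝ E] [FiniteDimensional ℝ E]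
  {M : Type*} [TopologicalSpace M] [ChartedSpace E M] [IsManifold 𝓘(ℝ, E) ∞ M]
  [RiemannianBundle (fun x : M => TangentSpace 𝓘(ℝ, E) x)]
  [IsContMDiffRiemannianBundle 𝓘(ℝ, E) ∞ E (fun x : M => TangentSpace 𝓘(ℝ, E) x)]

/-- `D` is the Levi-Civita connection of the Riemannian manifold `M`: a smooth affine connection
(covariant derivatives of smooth vector fields are smooth) that is compatible with the metric and
has vanishing torsion. -/
structure IsLeviCivita
    (D : CovariantDerivative 𝓘(ℝ, E) E (TangentSpace 𝓘(ℝ, E) : M → Type _)) : Prop where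
  smooth : CovariantDerivative.ContMDiffCovariantDerivative D ∞
  metric : CovariantDerivative.IsMetricCompatible (F := E)
    (V := fun x : M => TangentSpace 𝓘(ℝ, E) x) D
  torsion_free : D.torsion = 0

variable (D : CovariantDerivative 𝓘(ℝ, E) E (TangentSpace 𝓘(ℝ, E) : M → Type _))

/-- Every tangent plane has sectional curvature `c`: if `u` and `v` span it, then
`⟨R(u, v) v, u⟩ = c (|u|² |v|² - ⟨u, v⟩²)`. (For linearly dependent `u` and `v` both sides
vanish.) -/
def HasConstantCurvature (c : ℝ) : Prop :=
  ∀ (x : M) (u v : TangentSpace 𝓘(ℝ, E) x),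
    inner ℝ (curvatureTensor D x u v v) u = c * (‖u‖ ^ 2 * ‖v‖ ^ 2 - inner ℝ u v ^ 2)

/-! For a curve `γ`, viewed as a map from an interval with the metric `dt²`, the one vector field
`d/dt` is an orthonormal frame with `∇_{d/dt} d/dt = 0`, so that `|dγ| = |γ'|`, the trace of a
bilinear form is its value on `(d/dt, d/dt)`, and the divergence of `f dγ` is `D_{d/dt} (f γ')`. -/

/-- The `p`-tension field `τ_p(γ) = div (|dγ|^(p-2) dγ)` of a curve. -/
def pTension (p : ℝ) (γ : ℝ → M) (t : ℝ) : TangentSpace 𝓘(ℝ, E) (γ t) :=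
  covDerivAlong D γ (fun r => ‖velocity (E := E) γ r‖ ^ (p - 2) • velocity (E := E) γ r) t

/-- The field `|τ_p(γ)|^(q-2) τ_p(γ)` along a curve. -/
def pqField (p q : ℝ) (γ : ℝ → M) (t : ℝ) : TangentSpace 𝓘(ℝ, E) (γ t) :=
  ‖pTension D p γ t‖ ^ (q - 2) • pTension D p γ t

/-- The field `|dγ|^(p-2) ∇(|τ_p(γ)|^(q-2) τ_p(γ))` along a curve. -/
def pqFlux₁ (p q : ℝ) (γ : ℝ → M) (t : ℝ) : TangentSpace 𝓘(ℝ, E) (γ t) :=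
  ‖velocity (E := E) γ t‖ ^ (p - 2) • covDerivAlong D γ (pqField D p q γ) t

/-- The field `|dγ|^(p-4) ⟨∇(|τ_p(γ)|^(q-2) τ_p(γ)), dγ⟩ dγ` along a curve. -/
def pqFlux₂ (p q : ℝ) (γ : ℝ → M) (t : ℝ) : TangentSpace 𝓘(ℝ, E) (γ t) :=
  (‖velocity (E := E) γ t‖ ^ (p - 4) *
    inner ℝ (covDerivAlong D γ (pqField D p q γ) t) (velocity (E := E) γ t)) •
      velocity (E := E) γ t

/-- The `(p,q)`-tension field of a curve:
`τ_{p,q}(γ) = - |dγ|^(p-2) |τ_p|^(q-2) tr R(τ_p, dγ) dγ - tr ∇ (|dγ|^(p-2) ∇ (|τ_p|^(q-2) τ_p))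
  - (p-2) tr ∇ (|dγ|^(p-4) ⟨∇ (|τ_p|^(q-2) τ_p), dγ⟩ dγ)`. -/
def pqTension (p q : ℝ) (γ : ℝ → M) (t : ℝ) : TangentSpace 𝓘(ℝ, E) (γ t) :=
  -((‖velocity (E := E) γ t‖ ^ (p - 2) * ‖pTension D p γ t‖ ^ (q - 2)) •
      curvatureTensor D (γ t) (pTension D p γ t) (velocity γ t) (velocity γ t))
    - covDerivAlong D γ (pqFlux₁ D p q γ) t
    - (p - 2) • covDerivAlong D γ (pqFlux₂ D p q γ) t

/-- The curve `γ` is `p`-harmonic on `s`: its `p`-tension field vanishes. -/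
def IsPHarmonicOn (p : ℝ) (γ : ℝ → M) (s : Set ℝ) : Prop :=
  ∀ t ∈ s, pTension D p γ t = 0

/-- The curve `γ` is `(p,q)`-harmonic on `s`: its `(p,q)`-tension field exists (the derivatives in
it are derivatives of differentiable fields, which is automatic wherever `γ' ≠ 0` and `τ_p ≠ 0`)
and vanishes. -/
def IsPQHarmonicOn (p q : ℝ) (γ : ℝ → M) (s : Set ℝ) : Prop :=
  ∀ t ∈ s, DiffAlongAt (pqField D p q γ) t ∧ DiffAlongAt (pqFlux₁ D p q γ) t ∧
    DiffAlongAt (pqFlux₂ D p q γ) t ∧ pqTension D p q γ t = 0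

/-- The curve `γ` is proper `(p,q)`-harmonic on `s`: `(p,q)`-harmonic but not `p`-harmonic. -/
def IsProperPQHarmonicOn (p q : ℝ) (γ : ℝ → M) (s : Set ℝ) : Prop :=
  IsPQHarmonicOn D p q γ s ∧ ¬ IsPHarmonicOn D p γ s

/-- `(T, N, B)` with `T = γ'` is a Frenet frame along the unit speed curve `γ : s → M` in a
three-dimensional manifold, `k` is the geodesic curvature and `τ` the geodesic torsion of `γ`. As
`k > 0`, the field `N` and the function `k` are determined by `D_T T = k N`. The smooth field `B` is
determined by a choice of orientation along `γ`; the opposite choice changes the signs of `B` and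
`τ`. -/
structure IsFrenetFrameOn (γ : ℝ → M) (s : Set ℝ) (N B : ∀ t, TangentSpace 𝓘(ℝ, E) (γ t))
    (k τ : ℝ → ℝ) : Prop where
  smooth_normal : SmoothAlongOn N s
  smooth_binormal : SmoothAlongOn B s
  orthonormal : ∀ t ∈ s, Orthonormal ℝ ![velocity γ t, N t, B t]
  curvature_pos : ∀ t ∈ s, 0 < k t
  deriv_tangent : ∀ t ∈ s, covDerivAlong D γ (velocity γ) t = k t • N t
  deriv_normal : ∀ t ∈ s, covDerivAlong D γ N t = -(k t • velocity (E := E) γ t) + τ t • B t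
  deriv_binormal : ∀ t ∈ s, covDerivAlong D γ B t = -(τ t • N t)

end Riemannian

end

/-!
Write `T` for the velocity of the unit speed curve `γ`, `W = ∇_T T` for its curvature vector and
`κ = |W|`. Then `τ_p(γ) = W`, `V = κ^(q-2) W` and, as `W` is normal to `T` and the sectional
curvature is constantly `c`, the curvature term of the `(p,q)`-tension field is `-κ^(q-2) c W`. This
uses that `R(u, v) v = c (|v|² u - ⟨u, v⟩ v)` (`curvatureTensor_of_hasConstantCurvature`), which
follows from the hypothesis on `⟨R(u, v) v, u⟩` by polarization, since `⟨R(u, v) v, w⟩` is symmetric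
in `u` and `w`. That symmetry in turn comes from the first Bianchi identity and the skew-symmetry of
the curvature endomorphisms.

Suppose that `γ` is `(p,q)`-harmonic. Where `κ ≠ 0`, the tangential component of the equation reads
`(q - 1 + (p - 1) q) κ^(q-1) κ' = 0`, hence `κ' = 0`. So `(κ⁴)' = 0` everywhere, and `κ` is constant
on the interval, even though it might have had zeros
(`IsPQHarmonicOn.norm_curvatureVector_eq`). If `γ` is not `p`-harmonic, the constant is positive.

For constant `κ = k > 0`, the equation is equivalent to `∇_T ∇_T W = ((p - 2) k² - c) W`
(`isPQHarmonicOn_iff`). Along a Frenet frame with constant curvature and torsion,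
`∇_T ∇_T W = -(k² + τ²) W`, so that the equation becomes `(p - 1) k² = c - τ²`. Conversely, put
`N = W / k`. The equation shows that `A = ∇_T N + k T` is normal to `T` and `N`, of constant length
`τ`, and that `∇_T A = -τ² N`; if `τ > 0`, then `B = A / τ` completes the Frenet frame
(`exists_isFrenetFrameOn`). If `τ = 0`, any smooth unit field `B` normal to `T` and `N` will do. In
dimension three such a field exists locally and is unique up to sign, and over an interval the local
choices can be glued without an orientation of the manifold (`exists_binormal`).

The covariant derivative along a curve is handled through `DiffAlongAt.induction`: a field along `γ`
is locally a combination of restrictions of vector fields of the manifold, so that the product rule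
for the metric and smoothness reduce to the corresponding properties of the connection.
-/

open Filter Topology

/-! ### Vector fields along curves -/

section Along

variable {E : Type*} [NormedAddCommGroup E] [NormedSpace ℝ E]
  {M : Type*} [TopologicalSpace M] [ChartedSpace E M] [IsManifold 𝓘(ℝ, E) ∞ M]
  {γ : ℝ → M} {V W : ∀ t, TangentSpace 𝓘(ℝ, E) (γ t)} {f : ℝ → ℝ} {t : ℝ} {s : Set ℝ}

/-- The components at `r` of a vector field `V` along `γ` in the local trivialization of the tangent
bundle around `γ t`. -/
noncomputable def alongCoord (γ : ℝ → M) (V : ∀ t, TangentSpace 𝓘(ℝ, E) (γ t)) (t r : ℝ) : E :=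
  (trivializationAt E (TangentSpace 𝓘(ℝ, E)) (γ t)
    (⟨γ r, V r⟩ : TangentBundle 𝓘(ℝ, E) M)).2

lemma alongCoord_eq_continuousLinearMapAt {r : ℝ}
    (hr : γ r ∈ (trivializationAt E (TangentSpace 𝓘(ℝ, E)) (γ t)).baseSet) :
    alongCoord γ V t r =
      (trivializationAt E (TangentSpace 𝓘(ℝ, E)) (γ t)).continuousLinearMapAt ℝ (γ r) (V r) := by
  rw [alongCoord, Trivialization.continuousLinearMapAt_apply,
    Trivialization.linearMapAt_apply, if_pos hr]

lemma eventually_mem_baseSet (hγ : ContinuousAt γ t) :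
    ∀ᶠ r in 𝓝 t, γ r ∈ (trivializationAt E (TangentSpace 𝓘(ℝ, E)) (γ t)).baseSet :=
  hγ.eventually ((trivializationAt E (TangentSpace 𝓘(ℝ, E)) (γ t)).open_baseSet.mem_nhds
    (FiberBundle.mem_baseSet_trivializationAt E (TangentSpace 𝓘(ℝ, E)) (γ t)))

lemma diffAlongAt_iff : DiffAlongAt V t ↔
    MDifferentiableAt 𝓘(ℝ, ℝ) 𝓘(ℝ, E) γ t ∧ DifferentiableAt ℝ (alongCoord γ V t) t := by
  rw [DiffAlongAt, mdifferentiableAt_totalSpace, ← mdifferentiableAt_iff_differentiableAt]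
  rfl

lemma smoothAlongAt_iff : ContMDiffAt 𝓘(ℝ, ℝ) 𝓘(ℝ, E).tangent ∞
      (fun r => (⟨γ r, V r⟩ : TangentBundle 𝓘(ℝ, E) M)) t ↔
    ContMDiffAt 𝓘(ℝ, ℝ) 𝓘(ℝ, E) ∞ γ t ∧ ContDiffAt ℝ ∞ (alongCoord γ V t) t := by
  rw [contMDiffAt_totalSpace, ← contMDiffAt_iff_contDiffAt]
  rfl

lemma smoothAlongOn_iff (hs : IsOpen s) : SmoothAlongOn V s ↔ ∀ t ∈ s,
    ContMDiffAt 𝓘(ℝ, ℝ) 𝓘(ℝ, E).tangent ∞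
      (fun r => (⟨γ r, V r⟩ : TangentBundle 𝓘(ℝ, E) M)) t :=
  ⟨fun h _ ht => h.contMDiffAt (hs.mem_nhds ht), fun h _ ht => (h _ ht).contMDiffWithinAt⟩

lemma SmoothAlongOn.diffAlongAt (hV : SmoothAlongOn V s) (hs : IsOpen s) (ht : t ∈ s) :
    DiffAlongAt V t :=
  ((smoothAlongOn_iff hs).1 hV t ht).mdifferentiableAt (by simp)

lemma DiffAlongAt.mdifferentiableAt (hV : DiffAlongAt V t) :
    MDifferentiableAt 𝓘(ℝ, ℝ) 𝓘(ℝ, E) γ t := (diffAlongAt_iff.1 hV).1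

lemma DiffAlongAt.congr (hV : DiffAlongAt V t) (h : ∀ᶠ r in 𝓝 t, W r = V r) :
    DiffAlongAt W t :=
  MDifferentiableAt.congr_of_eventuallyEq hV (h.mono fun r hr => by simp only [hr])

lemma SmoothAlongOn.congr (hV : SmoothAlongOn V s) (h : ∀ r ∈ s, W r = V r) :
    SmoothAlongOn W s :=
  ContMDiffOn.congr hV fun r hr => by simp only [h r hr]

lemma alongCoord_add (hγ : ContinuousAt γ t) :
    alongCoord γ (fun r => V r + W r) t =ᶠ[𝓝 t]
      fun r => alongCoord γ V t r + alongCoord γ W t r := by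
  filter_upwards [eventually_mem_baseSet (E := E) hγ] with r hr
  simp only [alongCoord_eq_continuousLinearMapAt hr, map_add]

lemma alongCoord_smul (hγ : ContinuousAt γ t) :
    alongCoord γ (fun r => f r • V r) t =ᶠ[𝓝 t] fun r => f r • alongCoord γ V t r := by
  filter_upwards [eventually_mem_baseSet (E := E) hγ] with r hr
  simp only [alongCoord_eq_continuousLinearMapAt hr, map_smul]

lemma DiffAlongAt.add (hV : DiffAlongAt V t) (hW : DiffAlongAt W t) :
    DiffAlongAt (fun r => V r + W r) t := by
  rw [diffAlongAt_iff] at *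
  exact ⟨hV.1, (hV.2.add hW.2).congr_of_eventuallyEq (alongCoord_add (E := E) hV.1.continuousAt)⟩

lemma DiffAlongAt.smul (hf : DifferentiableAt ℝ f t) (hV : DiffAlongAt V t) :
    DiffAlongAt (fun r => f r • V r) t := by
  rw [diffAlongAt_iff] at *
  exact ⟨hV.1, (hf.smul hV.2).congr_of_eventuallyEq (alongCoord_smul (E := E) hV.1.continuousAt)⟩

lemma SmoothAlongOn.add (hs : IsOpen s) (hV : SmoothAlongOn V s) (hW : SmoothAlongOn W s) :
    SmoothAlongOn (fun r => V r + W r) s := by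
  simp only [smoothAlongOn_iff hs, smoothAlongAt_iff] at *
  exact fun t ht => ⟨(hV t ht).1, ((hV t ht).2.add (hW t ht).2).congr_of_eventuallyEq
    (alongCoord_add (E := E) (hV t ht).1.continuousAt)⟩

lemma SmoothAlongOn.smul (hs : IsOpen s) (hf : ContDiffOn ℝ ∞ f s) (hV : SmoothAlongOn V s) :
    SmoothAlongOn (fun r => f r • V r) s := by
  simp only [smoothAlongOn_iff hs, smoothAlongAt_iff] at *
  exact fun t ht => ⟨(hV t ht).1,
    ((hf.contDiffAt (hs.mem_nhds ht)).smul (hV t ht).2).congr_of_eventuallyEq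
    (alongCoord_smul (E := E) (hV t ht).1.continuousAt)⟩

lemma smoothAlongOn_velocity (hs : IsOpen s) (hγ : ContMDiffOn 𝓘(ℝ, ℝ) 𝓘(ℝ, E) ∞ γ s) :
    SmoothAlongOn (E := E) (velocity γ) s := by
  have h1 := hγ.contMDiffOn_tangentMapWithin (m := ∞) (by simp) hs.uniqueMDiffOn
  have h2 : ContMDiff 𝓘(ℝ, ℝ) 𝓘(ℝ, ℝ).tangent ∞
      (fun t : ℝ => (⟨t, (1 : ℝ)⟩ : TangentBundle 𝓘(ℝ, ℝ) ℝ)) := by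
    intro t
    rw [contMDiffAt_totalSpace]
    refine ⟨contMDiffAt_id, ?_⟩
    simpa using contMDiffAt_const
  have h3 := h1.comp h2.contMDiffOn (s := s) (fun t ht => ht)
  refine h3.congr fun t ht => ?_
  simp only [Function.comp, tangentMapWithin, velocity]
  rw [mfderivWithin_of_isOpen hs ht]

lemma smoothAlongOn_comp {X : ∀ x : M, TangentSpace 𝓘(ℝ, E) x} {u : Set M}
    (hX : ContMDiffOn 𝓘(ℝ, E) 𝓘(ℝ, E).tangent ∞ (fun x => (⟨x, X x⟩ : TangentBundle 𝓘(ℝ, E) M)) u)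
    (hγ : ContMDiffOn 𝓘(ℝ, ℝ) 𝓘(ℝ, E) ∞ γ s) (h : MapsTo γ s u) :
    SmoothAlongOn (fun r => X (γ r)) s :=
  hX.comp hγ h

lemma DiffAlongAt.sum {ι : Type*} {V : ι → ∀ t, TangentSpace 𝓘(ℝ, E) (γ t)} (a : Finset ι)
    (hγ : MDifferentiableAt 𝓘(ℝ, ℝ) 𝓘(ℝ, E) γ t) (hV : ∀ i ∈ a, DiffAlongAt (V i) t) :
    DiffAlongAt (fun r => ∑ i ∈ a, V i r) t := by
  classical
  induction a using Finset.induction_on with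
  | empty =>
    simp only [Finset.sum_empty]
    exact (mdifferentiable_zeroSection ℝ (TangentSpace 𝓘(ℝ, E)) (γ t)).comp t hγ
  | insert i a hi h =>
    simp only [Finset.sum_insert hi]
    simp only [Finset.mem_insert, forall_eq_or_imp] at hV
    exact hV.1.add (h hV.2)

lemma SmoothAlongOn.sum {ι : Type*} {V : ι → ∀ t, TangentSpace 𝓘(ℝ, E) (γ t)} (a : Finset ι)
    (hs : IsOpen s) (hγ : ContMDiffOn 𝓘(ℝ, ℝ) 𝓘(ℝ, E) ∞ γ s)
    (hV : ∀ i ∈ a, SmoothAlongOn (V i) s) :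
    SmoothAlongOn (fun r => ∑ i ∈ a, V i r) s := by
  classical
  induction a using Finset.induction_on with
  | empty =>
    simpa using smoothAlongOn_comp (γ := γ) (X := fun x => (0 : TangentSpace 𝓘(ℝ, E) x))
      (u := univ) (contMDiff_zeroSection ℝ (TangentSpace 𝓘(ℝ, E))).contMDiffOn hγ
      (mapsTo_univ _ _)
  | insert i a hi h =>
    simp only [Finset.sum_insert hi]
    simp only [Finset.mem_insert, forall_eq_or_imp] at hV
    exact hV.1.add hs (h hV.2)

end Along

/-! ### The covariant derivative along a curve -/

section CovDeriv

variable {E : Type*} [NormedAddCommGroup E] [NormedSpace ℝ E]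
  {M : Type*} [TopologicalSpace M] [ChartedSpace E M] [IsManifold 𝓘(ℝ, E) ∞ M]
  {D : CovariantDerivative 𝓘(ℝ, E) E (TangentSpace 𝓘(ℝ, E) : M → Type _)}
  {γ : ℝ → M} {V W : ∀ t, TangentSpace 𝓘(ℝ, E) (γ t)} {f : ℝ → ℝ} {t : ℝ} {s : Set ℝ}

lemma extend_eq_symmL {x y : M} (w : TangentSpace 𝓘(ℝ, E) x)
    (hy : y ∈ (trivializationAt E (TangentSpace 𝓘(ℝ, E)) x).baseSet) :
    (FiberBundle.extend E w : ∀ y, TangentSpace 𝓘(ℝ, E) y) y =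
      (trivializationAt E (TangentSpace 𝓘(ℝ, E)) x).symmL ℝ y
        ((trivializationAt E (TangentSpace 𝓘(ℝ, E)) x).continuousLinearMapAt ℝ x w) := by
  rw [Trivialization.symmL_apply _ hy, Trivialization.continuousLinearMapAt_apply,
    Trivialization.linearMapAt_apply, if_pos (FiberBundle.mem_baseSet_trivializationAt ..)]
  rfl

lemma extend_add_eventuallyEq {x : M} (u v : TangentSpace 𝓘(ℝ, E) x) :
    ∀ᶠ y in 𝓝 x, (FiberBundle.extend E (u + v) : ∀ y, TangentSpace 𝓘(ℝ, E) y) y =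
      FiberBundle.extend E u y + FiberBundle.extend E v y := by
  filter_upwards [(trivializationAt E (TangentSpace 𝓘(ℝ, E)) x).open_baseSet.mem_nhds
    (FiberBundle.mem_baseSet_trivializationAt E (TangentSpace 𝓘(ℝ, E)) x)] with y hy
  simp only [extend_eq_symmL _ hy, map_add]

lemma extend_smul_eventuallyEq {x : M} (a : ℝ) (u : TangentSpace 𝓘(ℝ, E) x) :
    ∀ᶠ y in 𝓝 x, (FiberBundle.extend E (a • u) : ∀ y, TangentSpace 𝓘(ℝ, E) y) y =
      a • FiberBundle.extend E u y := by
  filter_upwards [(trivializationAt E (TangentSpace 𝓘(ℝ, E)) x).open_baseSet.mem_nhds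
    (FiberBundle.mem_baseSet_trivializationAt E (TangentSpace 𝓘(ℝ, E)) x)] with y hy
  simp only [extend_eq_symmL _ hy, map_smul]

lemma mdifferentiableAt_extend {x : M} (u : TangentSpace 𝓘(ℝ, E) x) :
    MDifferentiableAt 𝓘(ℝ, E) 𝓘(ℝ, E).tangent (fun y => (⟨y, FiberBundle.extend E u y⟩ :
      TangentBundle 𝓘(ℝ, E) M)) x :=
  FiberBundle.mdifferentiableAt_extend ..

/-- The term `D_{γ'} (extend (V t))` of `covDerivAlong` is linear in `V t`, because the extension is
so near the base point. -/
lemma cov_extend_add {x : M} (u v : TangentSpace 𝓘(ℝ, E) x) :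
    D (FiberBundle.extend E (u + v)) x =
      D (FiberBundle.extend E u) x + D (FiberBundle.extend E v) x := by
  have hu := mdifferentiableAt_extend u
  have hv := mdifferentiableAt_extend v
  rw [← D.isCovariantDerivativeOnUniv.add hu hv]
  exact D.isCovariantDerivativeOnUniv.congr_of_eventuallyEq (mdifferentiableAt_extend _)
    (mdifferentiableAt_add_section hu hv) univ_mem (extend_add_eventuallyEq u v)

lemma cov_extend_smul {x : M} (a : ℝ) (u : TangentSpace 𝓘(ℝ, E) x) :
    D (FiberBundle.extend E (a • u)) x = a • D (FiberBundle.extend E u) x := by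
  have hu := mdifferentiableAt_extend u
  rw [← D.isCovariantDerivativeOnUniv.smul_const a hu]
  exact D.isCovariantDerivativeOnUniv.congr_of_eventuallyEq (mdifferentiableAt_extend _)
    (MDifferentiableAt.smul_const_section hu) univ_mem (extend_smul_eventuallyEq a u)

lemma covDerivAlong_eq (γ : ℝ → M) (V : ∀ t, TangentSpace 𝓘(ℝ, E) (γ t)) (t : ℝ) :
    covDerivAlong D γ V t =
      (trivializationAt E (TangentSpace 𝓘(ℝ, E)) (γ t)).symmL ℝ (γ t) (deriv (alongCoord γ V t) t)
      + D (FiberBundle.extend E (V t)) (γ t) (velocity γ t) := by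
  rw [Trivialization.symmL_apply _ (FiberBundle.mem_baseSet_trivializationAt E _ (γ t))]
  rfl

lemma covDerivAlong_congr (h : ∀ᶠ r in 𝓝 t, V r = W r) :
    covDerivAlong D γ V t = covDerivAlong D γ W t := by
  have h1 : alongCoord γ V t =ᶠ[𝓝 t] alongCoord γ W t :=
    h.mono fun r hr => by simp only [alongCoord, hr]
  rw [covDerivAlong_eq, covDerivAlong_eq, h1.deriv_eq, h.self_of_nhds]

lemma covDerivAlong_add (hV : DiffAlongAt V t) (hW : DiffAlongAt W t) :
    covDerivAlong D γ (fun r => V r + W r) t = covDerivAlong D γ V t + covDerivAlong D γ W t := by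
  have h := alongCoord_add (V := V) (W := W) hV.mdifferentiableAt.continuousAt
  rw [covDerivAlong_eq, covDerivAlong_eq, covDerivAlong_eq, h.deriv_eq,
    deriv_fun_add (diffAlongAt_iff.1 hV).2 (diffAlongAt_iff.1 hW).2, cov_extend_add, map_add,
    add_apply]
  abel

lemma covDerivAlong_smul (hf : DifferentiableAt ℝ f t) (hV : DiffAlongAt V t) :
    covDerivAlong D γ (fun r => f r • V r) t = deriv f t • V t + f t • covDerivAlong D γ V t := by
  have h := alongCoord_smul (V := V) (f := f) hV.mdifferentiableAt.continuousAt
  have hx := FiberBundle.mem_baseSet_trivializationAt E (TangentSpace 𝓘(ℝ, E)) (γ t)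
  have h2 : (trivializationAt E (TangentSpace 𝓘(ℝ, E)) (γ t)).symmL ℝ (γ t) (alongCoord γ V t t)
      = V t := by
    rw [alongCoord_eq_continuousLinearMapAt hx, Trivialization.symmL_continuousLinearMapAt _ hx]
  rw [covDerivAlong_eq, covDerivAlong_eq, h.deriv_eq,
    deriv_fun_smul hf (diffAlongAt_iff.1 hV).2, cov_extend_smul, map_add, map_smul, map_smul, h2,
    smul_apply, smul_add]
  abel

lemma covDerivAlong_const_smul (a : ℝ) (hV : DiffAlongAt V t) :
    covDerivAlong D γ (fun r => a • V r) t = a • covDerivAlong D γ V t := by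
  simpa using covDerivAlong_smul (D := D) (f := fun _ => a) (by fun_prop) hV

lemma diffAlongAt_comp {X : ∀ x : M, TangentSpace 𝓘(ℝ, E) x}
    (hX : MDifferentiableAt 𝓘(ℝ, E) 𝓘(ℝ, E).tangent
      (fun x => (⟨x, X x⟩ : TangentBundle 𝓘(ℝ, E) M)) (γ t))
    (hγ : MDifferentiableAt 𝓘(ℝ, ℝ) 𝓘(ℝ, E) γ t) : DiffAlongAt (fun r => X (γ r)) t :=
  hX.comp t hγ

/-- The covariant derivative along `γ` of the restriction of a vector field `X` of the manifold is
`D_{γ'} X`. -/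
lemma covDerivAlong_comp [FiniteDimensional ℝ E] {X : ∀ x : M, TangentSpace 𝓘(ℝ, E) x}
    (hX : MDifferentiableAt 𝓘(ℝ, E) 𝓘(ℝ, E).tangent
      (fun x => (⟨x, X x⟩ : TangentBundle 𝓘(ℝ, E) M)) (γ t))
    (hγ : MDifferentiableAt 𝓘(ℝ, ℝ) 𝓘(ℝ, E) γ t) :
    covDerivAlong D γ (fun r => X (γ r)) t = D X (γ t) (velocity γ t) := by
  -- The defect is tensorial in `X`, and vanishes for the fields of constant components.
  have hT : TensorialAt 𝓘(ℝ, E) E (fun X : ∀ x : M, TangentSpace 𝓘(ℝ, E) x =>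
      covDerivAlong D γ (fun r => X (γ r)) t - D X (γ t) (velocity γ t)) (γ t) := by
    constructor
    · intro g Y hg hY
      have hgγ : DifferentiableAt ℝ (fun r => g (γ r)) t :=
        mdifferentiableAt_iff_differentiableAt.1 (hg.comp t hγ)
      have h1 := covDerivAlong_smul (D := D) hgγ (diffAlongAt_comp hY hγ)
      have h2 : deriv (fun r => g (γ r)) t = d% g (γ t) (velocity γ t) := by
        have := mvfderiv_comp_apply t hg hγ (1 : ℝ)
        rw [velocity, ← this, ← fderiv_apply_one_eq_deriv, mvfderiv, mfderiv_eq_fderiv]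
        rfl
      simp only [Pi.smul_apply'] at h1 ⊢
      rw [h1, D.isCovariantDerivativeOnUniv.leibniz hY hg, h2]
      simp only [add_apply, smul_apply,
        ContinuousLinearMap.smulRight_apply, smul_sub]
      abel
    · intro Y Z hY hZ
      have h1 := covDerivAlong_add (D := D) (diffAlongAt_comp hY hγ) (diffAlongAt_comp hZ hγ)
      simp only [Pi.add_apply] at h1 ⊢
      rw [h1, D.isCovariantDerivativeOnUniv.add hY hZ]
      simp only [add_apply]
      abel
  have h0 := hT.pointwise hX (mdifferentiableAt_extend (X (γ t)))
    (FiberBundle.extend_apply_self E (X (γ t))).symm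
  have h1 : covDerivAlong D γ (fun r => FiberBundle.extend E (X (γ t)) (γ r)) t
      - D (FiberBundle.extend E (X (γ t))) (γ t) (velocity γ t) = 0 := by
    have h2 : alongCoord γ (fun r => FiberBundle.extend E (X (γ t)) (γ r)) t =ᶠ[𝓝 t]
        fun _ => alongCoord γ (fun r => X (γ r)) t t := by
      filter_upwards [eventually_mem_baseSet (E := E) hγ.continuousAt] with r hr
      rw [alongCoord, FiberBundle.extend, Trivialization.apply_mk_symm _ hr]
      rfl
    rw [covDerivAlong_eq, h2.deriv_eq, FiberBundle.extend_apply_self]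
    simp
  exact sub_eq_zero.1 (h0.trans h1)

end CovDeriv

/-! ### Local frames and smoothness of covariant derivatives -/

section Frame

variable {E : Type*} [NormedAddCommGroup E] [NormedSpace ℝ E] [FiniteDimensional ℝ E]
  {M : Type*} [TopologicalSpace M] [ChartedSpace E M] [IsManifold 𝓘(ℝ, E) ∞ M]
  {D : CovariantDerivative 𝓘(ℝ, E) E (TangentSpace 𝓘(ℝ, E) : M → Type _)}
  {γ : ℝ → M} {V W : ∀ t, TangentSpace 𝓘(ℝ, E) (γ t)} {f : ℝ → ℝ} {t : ℝ} {s : Set ℝ}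

/-- The local frame of the tangent bundle which is constant in the trivialization around `x`. -/
noncomputable def coordFrame (x : M) (i : Fin (Module.finrank ℝ E)) (y : M) :
    TangentSpace 𝓘(ℝ, E) y :=
  (trivializationAt E (TangentSpace 𝓘(ℝ, E)) x).localFrame (Module.finBasis ℝ E) i y

lemma contMDiffOn_coordFrame (x : M) (i : Fin (Module.finrank ℝ E)) :
    ContMDiffOn 𝓘(ℝ, E) 𝓘(ℝ, E).tangent ∞
      (fun y => (⟨y, coordFrame x i y⟩ : TangentBundle 𝓘(ℝ, E) M))
      (trivializationAt E (TangentSpace 𝓘(ℝ, E)) x).baseSet :=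
  (trivializationAt E (TangentSpace 𝓘(ℝ, E)) x).contMDiffOn_localFrame_baseSet ∞
    (Module.finBasis ℝ E) i

/-- The components of a vector field along `γ` in the frame `coordFrame (γ t)`. -/
noncomputable def frameCoord (γ : ℝ → M) (V : ∀ t, TangentSpace 𝓘(ℝ, E) (γ t)) (t : ℝ)
    (i : Fin (Module.finrank ℝ E)) (r : ℝ) : ℝ :=
  (Module.finBasis ℝ E).repr (alongCoord γ V t r) i

lemma eq_sum_coordFrame {r : ℝ} (V : ∀ t, TangentSpace 𝓘(ℝ, E) (γ t))
    (hr : γ r ∈ (trivializationAt E (TangentSpace 𝓘(ℝ, E)) (γ t)).baseSet) :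
    V r = ∑ i, frameCoord γ V t i r • coordFrame (γ t) i (γ r) := by
  have h := ((trivializationAt E (TangentSpace 𝓘(ℝ, E)) (γ t)).basisAt
    (Module.finBasis ℝ E) hr).sum_repr (V r)
  refine h.symm.trans (Finset.sum_congr rfl fun i _ => ?_)
  rw [coordFrame, Trivialization.localFrame_apply_of_mem_baseSet _ _ hr]
  rfl

lemma frameCoord_eq_comp (γ : ℝ → M) (V : ∀ t, TangentSpace 𝓘(ℝ, E) (γ t)) (t : ℝ)
    (i : Fin (Module.finrank ℝ E)) : frameCoord γ V t i =
      LinearMap.toContinuousLinearMap ((Module.finBasis ℝ E).coord i) ∘ alongCoord γ V t := rfl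

/-- Every differentiable field along `γ` is locally a combination of restrictions of vector fields
of the manifold, so that a property of fields along `γ` may be checked on the latter. -/
theorem DiffAlongAt.induction {P : (∀ r, TangentSpace 𝓘(ℝ, E) (γ r)) → Prop}
    (congr : ∀ V W : ∀ r, TangentSpace 𝓘(ℝ, E) (γ r), (∀ᶠ r in 𝓝 t, W r = V r) → P V → P W)
    (add : ∀ V W : ∀ r, TangentSpace 𝓘(ℝ, E) (γ r), DiffAlongAt V t → DiffAlongAt W t →
      P V → P W → P (fun r => V r + W r))
    (smul : ∀ (f : ℝ → ℝ) (V : ∀ r, TangentSpace 𝓘(ℝ, E) (γ r)), DifferentiableAt ℝ f t →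
      DiffAlongAt V t → P V → P (fun r => f r • V r))
    (comp : ∀ X : ∀ x : M, TangentSpace 𝓘(ℝ, E) x, MDifferentiableAt 𝓘(ℝ, E) 𝓘(ℝ, E).tangent
      (fun x => (⟨x, X x⟩ : TangentBundle 𝓘(ℝ, E) M)) (γ t) → P (fun r => X (γ r)))
    (hV : DiffAlongAt V t) : P V := by
  classical
  have hγ := hV.mdifferentiableAt
  have hX (i : Fin (Module.finrank ℝ E)) := ((contMDiffOn_coordFrame (γ t) i).contMDiffAt
    ((trivializationAt E (TangentSpace 𝓘(ℝ, E)) (γ t)).open_baseSet.mem_nhds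
      (FiberBundle.mem_baseSet_trivializationAt E _ (γ t)))).mdifferentiableAt (by simp)
  have hf (i : Fin (Module.finrank ℝ E)) : DifferentiableAt ℝ (frameCoord γ V t i) t := by
    rw [frameCoord_eq_comp]
    exact (ContinuousLinearMap.differentiableAt _).comp t (diffAlongAt_iff.1 hV).2
  have key (a : Finset (Fin (Module.finrank ℝ E))) :
      P (fun r => ∑ i ∈ a, frameCoord γ V t i r • coordFrame (γ t) i (γ r)) := by
    induction a using Finset.induction_on with
    | empty => simpa using comp (fun x => 0) (mdifferentiable_zeroSection ..)
    | insert i a hi h =>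
      simp only [Finset.sum_insert hi]
      refine add _ _ ((diffAlongAt_comp (hX i) hγ).smul (hf i))
        (DiffAlongAt.sum a hγ fun j _ => (diffAlongAt_comp (hX j) hγ).smul (hf j)) ?_ h
      exact smul _ _ (hf i) (diffAlongAt_comp (hX i) hγ) (comp _ (hX i))
  refine congr _ _ ?_ (key Finset.univ)
  filter_upwards [eventually_mem_baseSet (E := E) hγ.continuousAt] with r hr
  exact eq_sum_coordFrame V hr

lemma covDerivAlong_sum {ι : Type*} {V : ι → ∀ t, TangentSpace 𝓘(ℝ, E) (γ t)} (a : Finset ι)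
    (hγ : MDifferentiableAt 𝓘(ℝ, ℝ) 𝓘(ℝ, E) γ t) (hV : ∀ i ∈ a, DiffAlongAt (V i) t) :
    covDerivAlong D γ (fun r => ∑ i ∈ a, V i r) t = ∑ i ∈ a, covDerivAlong D γ (V i) t := by
  classical
  induction a using Finset.induction_on with
  | empty =>
    have h0 : D (fun _ => 0) = 0 := D.zero
    simpa [h0] using covDerivAlong_comp (D := D) (γ := γ) (X := fun x => 0)
      (mdifferentiable_zeroSection ..) hγ
  | insert i a hi h =>
    simp only [Finset.mem_insert, forall_eq_or_imp] at hV
    simp only [Finset.sum_insert hi]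
    rw [covDerivAlong_add hV.1 (DiffAlongAt.sum a hγ hV.2), h hV.2]

/-- A smooth connection maps locally smooth vector fields to locally smooth sections; the definition
of smoothness only speaks of global vector fields. -/
lemma contMDiffAt_cov [T2Space M] (hD : CovariantDerivative.ContMDiffCovariantDerivative D ∞)
    {X : ∀ x : M, TangentSpace 𝓘(ℝ, E) x} {u : Set M} (hu : IsOpen u)
    (hX : ContMDiffOn 𝓘(ℝ, E) 𝓘(ℝ, E).tangent ∞ (fun x => (⟨x, X x⟩ : TangentBundle 𝓘(ℝ, E) M)) u)
    {x : M} (hx : x ∈ u) :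
    ContMDiffAt 𝓘(ℝ, E) (𝓘(ℝ, E).prod 𝓘(ℝ, E →L[ℝ] E)) ∞
      (fun y => (⟨y, D X y⟩ : TotalSpace (E →L[ℝ] E)
        fun y : M => TangentSpace 𝓘(ℝ, E) y →L[ℝ] TangentSpace 𝓘(ℝ, E) y)) x := by
  obtain ⟨ψ, -, hψ⟩ := (SmoothBumpFunction.nhds_basis_tsupport (I := 𝓘(ℝ, E)) x).mem_iff.1
    (hu.mem_nhds hx)
  have hY := (ψ.contMDiff.contMDiffOn).smul_section_of_tsupport hu hψ hX
  have h := (hD.contMDiff.contMDiff (σ := (ψ : M → ℝ) • X)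
    (by simpa using hY.contMDiffOn)).contMDiffAt univ_mem (x := x)
  refine h.congr_of_eventuallyEq ?_
  filter_upwards [ψ.eventuallyEq_one.eventually_nhds, hu.mem_nhds hx] with y hy hyu
  have hXy := (hX.contMDiffAt (hu.mem_nhds hyu)).mdifferentiableAt (by simp)
  have : D X y = D ((ψ : M → ℝ) • X) y :=
    D.isCovariantDerivativeOnUniv.congr_of_eventuallyEq hXy (hY.mdifferentiableAt (by simp))
      univ_mem (hy.mono fun z hz => by simp [hz])
  rw [this]

lemma ContMDiffOn.cov_apply [T2Space M]
    (hD : CovariantDerivative.ContMDiffCovariantDerivative D ∞)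
    {X Y : ∀ x : M, TangentSpace 𝓘(ℝ, E) x} {u : Set M} (hu : IsOpen u)
    (hX : ContMDiffOn 𝓘(ℝ, E) 𝓘(ℝ, E).tangent ∞ (fun x => (⟨x, X x⟩ : TangentBundle 𝓘(ℝ, E) M)) u)
    (hY : ContMDiffOn 𝓘(ℝ, E) 𝓘(ℝ, E).tangent ∞
      (fun x => (⟨x, Y x⟩ : TangentBundle 𝓘(ℝ, E) M)) u) :
    ContMDiffOn 𝓘(ℝ, E) 𝓘(ℝ, E).tangent ∞
      (fun x => (⟨x, D X x (Y x)⟩ : TangentBundle 𝓘(ℝ, E) M)) u := fun _ hx =>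
  ((contMDiffAt_cov hD hu hX hx).clm_bundle_apply
    (hY.contMDiffAt (hu.mem_nhds hx))).contMDiffWithinAt

/-- The covariant derivative of a smooth field along a smooth curve is smooth. -/
theorem SmoothAlongOn.covDerivAlong [T2Space M]
    (hD : CovariantDerivative.ContMDiffCovariantDerivative D ∞)
    (hs : IsOpen s) (hγ : ContMDiffOn 𝓘(ℝ, ℝ) 𝓘(ℝ, E) ∞ γ s) (hV : SmoothAlongOn V s) :
    SmoothAlongOn (_root_.covDerivAlong D γ V) s := by
  rw [smoothAlongOn_iff hs]
  intro t ht
  -- Around `t`, expand `V` in the frame of the trivialization around `γ t`.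
  have hγ' : ∀ r ∈ s, ContMDiffAt 𝓘(ℝ, ℝ) 𝓘(ℝ, E) ∞ γ r := fun r hr =>
    hγ.contMDiffAt (hs.mem_nhds hr)
  let e := trivializationAt E (TangentSpace 𝓘(ℝ, E)) (γ t)
  let u := s ∩ γ ⁻¹' e.baseSet
  have hu : IsOpen u := hγ.continuousOn.isOpen_inter_preimage hs e.open_baseSet
  have hus : u ⊆ s := inter_subset_left
  have htu : t ∈ u := ⟨ht, FiberBundle.mem_baseSet_trivializationAt E (TangentSpace 𝓘(ℝ, E)) (γ t)⟩
  have hv (i : Fin (Module.finrank ℝ E)) : ContDiffOn ℝ ∞ (frameCoord γ V t i) u := by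
    intro r hr
    have h1 : r ∈ u → (⟨γ r, V r⟩ : TangentBundle 𝓘(ℝ, E) M) ∈ e.source := fun h =>
      e.mem_source.2 h.2
    have h2 := ((e.contMDiffAt_iff (IB := 𝓘(ℝ, E)) (n := ∞)
      (f := fun r => (⟨γ r, V r⟩ : TangentBundle 𝓘(ℝ, E) M)) (h1 hr)).1
      ((smoothAlongOn_iff hs).1 hV r hr.1)).2
    rw [frameCoord_eq_comp]
    exact ((ContinuousLinearMap.contDiff _).contDiffAt.comp r
      (contMDiffAt_iff_contDiffAt.1 h2)).contDiffWithinAt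
  have hX (i : Fin (Module.finrank ℝ E)) := contMDiffOn_coordFrame (γ t) i
  have hXu (i : Fin (Module.finrank ℝ E)) : SmoothAlongOn (fun r => coordFrame (γ t) i (γ r)) u :=
    smoothAlongOn_comp (hX i) (hγ.mono hus) fun r hr => hr.2
  have hDX (i : Fin (Module.finrank ℝ E)) :
      SmoothAlongOn (fun r => D (coordFrame (γ t) i) (γ r) (velocity γ r)) u := by
    rw [smoothAlongOn_iff hu]
    intro r hr
    exact ((contMDiffAt_cov hD e.open_baseSet (hX i) hr.2).comp r (hγ' r hr.1)).clm_bundle_apply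
      ((smoothAlongOn_iff hs).1 (smoothAlongOn_velocity hs hγ) r hr.1)
  have hsum : SmoothAlongOn (fun r => ∑ i, (deriv (frameCoord γ V t i) r •
      coordFrame (γ t) i (γ r) + frameCoord γ V t i r •
        D (coordFrame (γ t) i) (γ r) (velocity γ r))) u := by
    refine SmoothAlongOn.sum _ hu (hγ.mono hus) fun i _ => ?_
    exact ((hXu i).smul hu ((hv i).deriv_of_isOpen hu (by simp))).add hu ((hDX i).smul hu (hv i))
  refine (smoothAlongOn_iff hu).1 (hsum.congr fun r hr => ?_) t htu
  have hγr := (hγ' r hr.1).mdifferentiableAt (by simp)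
  have hvr (i : Fin (Module.finrank ℝ E)) : DifferentiableAt ℝ (frameCoord γ V t i) r :=
    ((hv i).contDiffAt (hu.mem_nhds hr)).differentiableAt (by simp)
  rw [covDerivAlong_congr (W := fun r => ∑ i, frameCoord γ V t i r • coordFrame (γ t) i (γ r))
    (eventually_of_mem (hu.mem_nhds hr) fun r hr => eq_sum_coordFrame V hr.2),
    covDerivAlong_sum _ hγr fun i _ => ((hXu i).diffAlongAt hu hr).smul (hvr i)]
  refine Finset.sum_congr rfl fun i _ => ?_
  rw [covDerivAlong_smul (hvr i) ((hXu i).diffAlongAt hu hr), covDerivAlong_comp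
    (((hX i).contMDiffAt (e.open_baseSet.mem_nhds hr.2)).mdifferentiableAt (by simp)) hγr]

end Frame

/-! ### Metric compatibility along a curve -/

section Metric

variable {E : Type*} [NormedAddCommGroup E] [NormedSpace ℝ E]
  {M : Type*} [TopologicalSpace M] [ChartedSpace E M] [IsManifold 𝓘(ℝ, E) ∞ M]
  [RiemannianBundle (fun x : M => TangentSpace 𝓘(ℝ, E) x)]
  [IsContMDiffRiemannianBundle 𝓘(ℝ, E) ∞ E (fun x : M => TangentSpace 𝓘(ℝ, E) x)]
  {D : CovariantDerivative 𝓘(ℝ, E) E (TangentSpace 𝓘(ℝ, E) : M → Type _)}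
  {γ : ℝ → M} {V W : ∀ t, TangentSpace 𝓘(ℝ, E) (γ t)} {f : ℝ → ℝ} {t : ℝ} {s : Set ℝ}

/-- Compatibility with the metric, for the covariant derivative along a curve. -/
theorem hasDerivAt_inner_along [FiniteDimensional ℝ E]
    (hD : CovariantDerivative.IsMetricCompatible (F := E)
      (V := fun x : M => TangentSpace 𝓘(ℝ, E) x) D)
    (hV : DiffAlongAt V t) (hW : DiffAlongAt W t) :
    HasDerivAt (fun r => inner ℝ (V r) (W r))
      (inner ℝ (covDerivAlong D γ V t) (W t) + inner ℝ (V t) (covDerivAlong D γ W t)) t := by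
  have hγ := hV.mdifferentiableAt
  refine DiffAlongAt.induction (t := t) (P := fun V => HasDerivAt (fun r => inner ℝ (V r) (W r))
    (inner ℝ (covDerivAlong D γ V t) (W t) + inner ℝ (V t) (covDerivAlong D γ W t)) t)
    ?_ ?_ ?_ ?_ hV
  · intro V V' h hP
    rw [covDerivAlong_congr h, h.self_of_nhds]
    exact hP.congr_of_eventuallyEq (h.mono fun r hr => by simp only [hr])
  · intro V V' h h' hP hP'
    rw [covDerivAlong_add h h']
    simp only [inner_add_left]
    exact (hP.add hP').congr_deriv (by ring)
  · intro f V hf h hP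
    rw [covDerivAlong_smul hf h]
    simp only [inner_add_left, real_inner_smul_left]
    exact (hf.hasDerivAt.mul hP).congr_deriv (by ring)
  intro X hX
  refine DiffAlongAt.induction (t := t) (P := fun W =>
    HasDerivAt (fun r => inner ℝ (X (γ r)) (W r))
    (inner ℝ (covDerivAlong D γ (fun r => X (γ r)) t) (W t) +
      inner ℝ (X (γ t)) (covDerivAlong D γ W t)) t) ?_ ?_ ?_ ?_ hW
  · intro V V' h hP
    rw [covDerivAlong_congr h, h.self_of_nhds]
    exact hP.congr_of_eventuallyEq (h.mono fun r hr => by simp only [hr])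
  · intro V V' h h' hP hP'
    rw [covDerivAlong_add h h']
    simp only [inner_add_right]
    exact (hP.add hP').congr_deriv (by ring)
  · intro f V hf h hP
    rw [covDerivAlong_smul hf h]
    simp only [inner_add_right, real_inner_smul_right]
    exact (hf.hasDerivAt.mul hP).congr_deriv (by ring)
  intro Y hY
  rw [covDerivAlong_comp hX hγ, covDerivAlong_comp hY hγ]
  have hXY : MDifferentiableAt 𝓘(ℝ, E) 𝓘(ℝ, ℝ) (fun x => inner ℝ (X x) (Y x)) (γ t) :=
    MDifferentiableAt.inner_bundle (E := fun x : M => TangentSpace 𝓘(ℝ, E) x) (b := fun x => x)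
      hX hY
  have h1 := hD.mvfderiv_inner_eq (FiberBundle.extend E (velocity γ t)) hX hY
  have h2 : HasDerivAt (fun r => inner ℝ (X (γ r)) (Y (γ r)))
      (d% (fun x => inner ℝ (X x) (Y x)) (γ t) (velocity γ t)) t := by
    have := mvfderiv_comp_apply t hXY hγ (1 : ℝ)
    have hd : DifferentiableAt ℝ (fun r => inner ℝ (X (γ r)) (Y (γ r))) t :=
      mdifferentiableAt_iff_differentiableAt.1 (hXY.comp t hγ)
    refine hd.hasDerivAt.congr_deriv ?_
    rw [velocity, ← this, ← fderiv_apply_one_eq_deriv, mvfderiv, mfderiv_eq_fderiv]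
    rfl
  refine h2.congr_deriv ?_
  simpa only [FiberBundle.extend_apply_self] using h1

lemma DiffAlongAt.differentiableAt_inner (hV : DiffAlongAt V t) (hW : DiffAlongAt W t) :
    DifferentiableAt ℝ (fun r => inner ℝ (V r) (W r)) t :=
  mdifferentiableAt_iff_differentiableAt.1 (MDifferentiableAt.inner_bundle hV hW)

lemma SmoothAlongOn.contDiffOn_inner (hV : SmoothAlongOn V s) (hW : SmoothAlongOn W s) :
    ContDiffOn ℝ ∞ (fun r => inner ℝ (V r) (W r)) s :=
  contMDiffOn_iff_contDiffOn.1 (ContMDiffOn.inner_bundle hV hW)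

end Metric

/-! ### The curvature tensor on vector fields -/

section Curvature

open VectorField

variable {E : Type*} [NormedAddCommGroup E] [NormedSpace ℝ E]
  {M : Type*} [TopologicalSpace M] [ChartedSpace E M] {x : M}

lemma mvfderiv_congr {f g : M → ℝ} (h : f =ᶠ[𝓝 x] g) : d% f x = d% g x := by
  ext v
  change mfderiv 𝓘(ℝ, E) 𝓘(ℝ, ℝ) f x v = mfderiv 𝓘(ℝ, E) 𝓘(ℝ, ℝ) g x v
  rw [h.mfderiv_eq]
  rfl

variable [IsManifold 𝓘(ℝ, E) ∞ M]
  {D : CovariantDerivative 𝓘(ℝ, E) E (TangentSpace 𝓘(ℝ, E) : M → Type _)}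
  {U V W Z : ∀ x : M, TangentSpace 𝓘(ℝ, E) x} {O : Set M}

/-- The vector field `X` is smooth on the set `O`. -/
def SmoothFieldOn (X : ∀ x : M, TangentSpace 𝓘(ℝ, E) x) (O : Set M) : Prop :=
  ContMDiffOn 𝓘(ℝ, E) 𝓘(ℝ, E).tangent ∞ (fun x => (⟨x, X x⟩ : TangentBundle 𝓘(ℝ, E) M)) O

lemma SmoothFieldOn.contMDiffAt (hV : SmoothFieldOn V O) (hO : IsOpen O) (hx : x ∈ O) :
    CMDiffAt ∞ (T% V) x := ContMDiffOn.contMDiffAt hV (hO.mem_nhds hx)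

lemma SmoothFieldOn.mdifferentiableAt (hV : SmoothFieldOn V O) (hO : IsOpen O) (hx : x ∈ O) :
    MDiffAt (T% V) x := (hV.contMDiffAt hO hx).mdifferentiableAt (by simp)

lemma isManifold_minSmoothness (n : ℕ∞ω) [ENat.LEInfty n] :
    IsManifold 𝓘(ℝ, E) (minSmoothness ℝ n) M :=
  .of_le (n := ∞) (by simpa using ENat.LEInfty.out)

lemma SmoothFieldOn.mlieBracket [CompleteSpace E] (hV : SmoothFieldOn V O) (hW : SmoothFieldOn W O)
    (hO : IsOpen O) : SmoothFieldOn (mlieBracket 𝓘(ℝ, E) V W) O := fun _ hy =>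
  have := isManifold_minSmoothness (E := E) (M := M) 2
  haveI : IsManifold 𝓘(ℝ, E) ((⊤ : ℕ∞) + 1) M := by simpa
  (ContMDiffAt.mlieBracket_vectorField (m := ⊤) (n := ⊤) (hV.contMDiffAt hO hy)
    (hW.contMDiffAt hO hy) (by simp)).contMDiffWithinAt

/-- The commutator of two vector fields, as derivations of functions, is their Lie bracket. This is
read off from the Jacobi identity for `U`, `V` and `f • Z`. -/
lemma mvfderiv_mvfderiv_sub [FiniteDimensional ℝ E] {f : M → ℝ} (hO : IsOpen O) (hx : x ∈ O)
    (hU : SmoothFieldOn U O) (hV : SmoothFieldOn V O) (hf : ContMDiffOn 𝓘(ℝ, E) 𝓘(ℝ, ℝ) ∞ f O)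
    (hUf : MDiffAt (fun y => d% f y (U y)) x) (hVf : MDiffAt (fun y => d% f y (V y)) x) :
    d% (fun y => d% f y (V y)) x (U x) - d% (fun y => d% f y (U y)) x (V x) =
      d% f x (mlieBracket 𝓘(ℝ, E) U V x) := by
  rcases subsingleton_or_nontrivial (TangentSpace 𝓘(ℝ, E) x) with h | h
  · rw [Subsingleton.elim (U x) 0, Subsingleton.elim (V x) 0,
      Subsingleton.elim (mlieBracket 𝓘(ℝ, E) U V x) 0]
    simp only [map_zero, sub_zero]
  obtain ⟨z, hz⟩ := exists_ne (0 : TangentSpace 𝓘(ℝ, E) x)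
  have := isManifold_minSmoothness (E := E) (M := M) 2
  have := isManifold_minSmoothness (E := E) (M := M) 3
  -- Shrink `O` so that `Z` with value `z` at `x` is smooth on it.
  let Z : ∀ y : M, TangentSpace 𝓘(ℝ, E) y := FiberBundle.extend E z
  have hZx : Z x = z := FiberBundle.extend_apply_self E z
  obtain ⟨O', hO', hZ⟩ : ∃ O' ∈ 𝓝 x, SmoothFieldOn Z O' :=
    FiberBundle.exists_contMDiffOn_extend 𝓘(ℝ, E) E z
  obtain ⟨O'', hO'', hO''o, hxO''⟩ := mem_nhds_iff.1 (inter_mem (hO.mem_nhds hx) hO')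
  replace hU : SmoothFieldOn U O'' := ContMDiffOn.mono hU fun y hy => (hO'' hy).1
  replace hV : SmoothFieldOn V O'' := ContMDiffOn.mono hV fun y hy => (hO'' hy).1
  replace hf := hf.mono fun y hy => (hO'' hy).1
  replace hZ : SmoothFieldOn Z O'' := ContMDiffOn.mono hZ fun y hy => (hO'' hy).2
  have hfd {y : M} (hy : y ∈ O'') : MDiffAt f y :=
    (hf.contMDiffAt (hO''o.mem_nhds hy)).mdifferentiableAt (by simp)
  have hs : ∀ {X : ∀ x : M, TangentSpace 𝓘(ℝ, E) x}, SmoothFieldOn X O'' →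
      ContMDiffAt 𝓘(ℝ, E) 𝓘(ℝ, E).tangent (minSmoothness ℝ 2) (T% X) x := fun hX =>
    (hX.contMDiffAt hO''o hxO'').of_le (by simpa using ENat.LEInfty.out)
  have hd : ∀ {X : ∀ x : M, TangentSpace 𝓘(ℝ, E) x}, SmoothFieldOn X O'' →
      MDiffAt (T% X) x := fun hX => hX.mdifferentiableAt hO''o hxO''
  have hfZ : SmoothFieldOn (f • Z) O'' := ContMDiffOn.smul_section hf hZ
  have expand : ∀ {X Y : ∀ x : M, TangentSpace 𝓘(ℝ, E) x}, SmoothFieldOn X O'' →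
      SmoothFieldOn Y O'' → MDiffAt (fun y => d% f y (Y y)) x →
      mlieBracket 𝓘(ℝ, E) X (mlieBracket 𝓘(ℝ, E) Y (f • Z)) x =
        d% (fun y => d% f y (Y y)) x (X x) • Z x + d% f x (Y x) • mlieBracket 𝓘(ℝ, E) X Z x +
          (d% f x (X x) • mlieBracket 𝓘(ℝ, E) Y Z x +
            f x • mlieBracket 𝓘(ℝ, E) X (mlieBracket 𝓘(ℝ, E) Y Z) x) := by
    intro X Y hX hY hYf
    have h1 : mlieBracket 𝓘(ℝ, E) Y (f • Z) =ᶠ[𝓝 x]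
        (fun y => d% f y (Y y)) • Z + f • mlieBracket 𝓘(ℝ, E) Y Z :=
      eventually_of_mem (hO''o.mem_nhds hxO'') fun y hy =>
        mlieBracket_smul_right (hfd hy) (hZ.mdifferentiableAt hO''o hy)
    have h2 : mlieBracket 𝓘(ℝ, E) X (mlieBracket 𝓘(ℝ, E) Y (f • Z)) x =
        mlieBracket 𝓘(ℝ, E) X ((fun y => d% f y (Y y)) • Z + f • mlieBracket 𝓘(ℝ, E) Y Z) x :=
      EventuallyEq.mlieBracket_vectorField_eq EventuallyEq.rfl h1
    rw [h2,
      mlieBracket_add_right (MDifferentiableAt.smul_section hYf (hd hZ))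
        (MDifferentiableAt.smul_section (hfd hxO'') (hd (hY.mlieBracket hZ hO''o))),
      mlieBracket_smul_right hYf (hd hZ),
      mlieBracket_smul_right (hfd hxO'') (hd (hY.mlieBracket hZ hO''o))]
  have hJ := leibniz_identity_mlieBracket_apply (hs hU) (hs hV) (hs hfZ)
  have hJ' := leibniz_identity_mlieBracket_apply (hs hU) (hs hV) (hs hZ)
  rw [expand hU hV hVf, expand hV hU hUf, mlieBracket_smul_right (hfd hxO'') (hd hZ), hJ', hZx]
    at hJ
  refine smul_left_injective ℝ hz ?_
  simp only [sub_smul]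
  linear_combination (norm := module) hJ

/-- The vector field `R(U, V) W = D_U D_V W - D_V D_U W - D_[U, V] W` of vector fields. -/
noncomputable def curvatureOf
    (D : CovariantDerivative 𝓘(ℝ, E) E (TangentSpace 𝓘(ℝ, E) : M → Type _))
    (U V W : ∀ x : M, TangentSpace 𝓘(ℝ, E) x) (x : M) : TangentSpace 𝓘(ℝ, E) x :=
  D (fun y => D W y (V y)) x (U x) - D (fun y => D W y (U y)) x (V x)
    - D W x (mlieBracket 𝓘(ℝ, E) U V x)

lemma curvatureOf_swap : curvatureOf D V U W x = -curvatureOf D U V W x := by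
  rw [curvatureOf, curvatureOf, mlieBracket_swap_apply, map_neg]
  abel

lemma SmoothFieldOn.cov [T2Space M] [FiniteDimensional ℝ E]
    (hD : CovariantDerivative.ContMDiffCovariantDerivative D ∞)
    (hO : IsOpen O) (hV : SmoothFieldOn V O) (hW : SmoothFieldOn W O) :
    SmoothFieldOn (fun y => D W y (V y)) O :=
  ContMDiffOn.cov_apply hD hO hW hV

/-- The first Bianchi identity. -/
lemma curvatureOf_bianchi [T2Space M] [FiniteDimensional ℝ E]
    (hD : CovariantDerivative.ContMDiffCovariantDerivative D ∞) (hT : D.torsion = 0)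
    (hO : IsOpen O) (hx : x ∈ O)
    (hU : SmoothFieldOn U O) (hV : SmoothFieldOn V O) (hW : SmoothFieldOn W O) :
    curvatureOf D U V W x + curvatureOf D V W U x + curvatureOf D W U V x = 0 := by
  have := isManifold_minSmoothness (E := E) (M := M) 2
  have := isManifold_minSmoothness (E := E) (M := M) 3
  have hT' : ∀ {X Y : ∀ x : M, TangentSpace 𝓘(ℝ, E) x} {x : M}, MDiffAt (T% X) x →
    MDiffAt (T% Y) x → D Y x (X x) - D X x (Y x) = mlieBracket 𝓘(ℝ, E) X Y x :=
    D.torsion_eq_zero_iff.1 hT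
  have key : ∀ {X Y Z : ∀ x : M, TangentSpace 𝓘(ℝ, E) x}, SmoothFieldOn X O → SmoothFieldOn Y O →
      SmoothFieldOn Z O → D (fun y => D Z y (Y y)) x (X x) - D (fun y => D Y y (Z y)) x (X x) =
        D X x (mlieBracket 𝓘(ℝ, E) Y Z x) +
          mlieBracket 𝓘(ℝ, E) X (mlieBracket 𝓘(ℝ, E) Y Z) x := by
    intro X Y Z hX hY hZ
    have h1 := hZ.cov hD hO hY
    have h2 := hY.mlieBracket hZ hO
    have h3 : D (fun y => D Z y (Y y)) x =
        D ((fun y => D Y y (Z y)) + mlieBracket 𝓘(ℝ, E) Y Z) x :=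
      D.isCovariantDerivativeOnUniv.congr_of_eventuallyEq
        ((hY.cov hD hO hZ).mdifferentiableAt hO hx)
        (mdifferentiableAt_add_section (h1.mdifferentiableAt hO hx) (h2.mdifferentiableAt hO hx))
        univ_mem (eventually_of_mem (hO.mem_nhds hx) fun y hy => by
          have := hT' (hY.mdifferentiableAt hO hy) (hZ.mdifferentiableAt hO hy)
          simp only [Pi.add_apply, ← this]
          abel)
    have h4 := hT' (hX.mdifferentiableAt hO hx) (h2.mdifferentiableAt hO hx)
    rw [h3, D.isCovariantDerivativeOnUniv.add (h1.mdifferentiableAt hO hx)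
      (h2.mdifferentiableAt hO hx), add_apply, ← h4]
    abel
  have h1 := key hU hV hW
  have h2 := key hV hU hW
  have h3 := key hW hU hV
  have hs : ∀ {X : ∀ x : M, TangentSpace 𝓘(ℝ, E) x}, SmoothFieldOn X O →
      ContMDiffAt 𝓘(ℝ, E) 𝓘(ℝ, E).tangent (minSmoothness ℝ 2) (T% X) x := fun hX =>
    (hX.contMDiffAt hO hx).of_le (by simpa using ENat.LEInfty.out)
  have hJ := leibniz_identity_mlieBracket_apply (hs hU) (hs hV) (hs hW)
  rw [mlieBracket_swap_apply (V := VectorField.mlieBracket 𝓘(ℝ, E) U V)] at hJ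
  rw [curvatureOf, curvatureOf, curvatureOf, mlieBracket_swap_apply (V := W), map_neg]
  linear_combination (norm := module) h1 - h2 + h3 + hJ

section Inner

variable [RiemannianBundle (fun x : M => TangentSpace 𝓘(ℝ, E) x)]
  [IsContMDiffRiemannianBundle 𝓘(ℝ, E) ∞ E (fun x : M => TangentSpace 𝓘(ℝ, E) x)]

lemma SmoothFieldOn.inner (hV : SmoothFieldOn V O) (hW : SmoothFieldOn W O) :
    ContMDiffOn 𝓘(ℝ, E) 𝓘(ℝ, ℝ) ∞ (fun y => inner ℝ (V y) (W y)) O :=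
  ContMDiffOn.inner_bundle (E := fun x : M => TangentSpace 𝓘(ℝ, E) x) (b := fun x => x) hV hW

end Inner

end Curvature

/-! ### Symmetries of the curvature and spaces of constant curvature -/

section SectionalCurvature

open VectorField

variable {E : Type*} [NormedAddCommGroup E] [NormedSpace ℝ E] [FiniteDimensional ℝ E]
  {M : Type*} [TopologicalSpace M] [ChartedSpace E M] [IsManifold 𝓘(ℝ, E) ∞ M]
  [RiemannianBundle (fun x : M => TangentSpace 𝓘(ℝ, E) x)]
  [IsContMDiffRiemannianBundle 𝓘(ℝ, E) ∞ E (fun x : M => TangentSpace 𝓘(ℝ, E) x)] [T2Space M]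
  {D : CovariantDerivative 𝓘(ℝ, E) E (TangentSpace 𝓘(ℝ, E) : M → Type _)}
  {U V W Z : ∀ x : M, TangentSpace 𝓘(ℝ, E) x} {O : Set M} {x : M}

/-- The curvature endomorphism of a metric connection is skew-symmetric. -/
lemma inner_curvatureOf_add (hD : IsLeviCivita D) (hO : IsOpen O) (hx : x ∈ O)
    (hU : SmoothFieldOn U O) (hV : SmoothFieldOn V O) (hW : SmoothFieldOn W O)
    (hZ : SmoothFieldOn Z O) :
    inner ℝ (curvatureOf D U V W x) (Z x) + inner ℝ (W x) (curvatureOf D U V Z x) = 0 := by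
  have d1 : ∀ {X Y Z : ∀ x : M, TangentSpace 𝓘(ℝ, E) x} {y : M}, y ∈ O → SmoothFieldOn X O →
      SmoothFieldOn Y O → d% (fun y => inner ℝ (X y) (Y y)) y (Z y) =
        inner ℝ (D X y (Z y)) (Y y) + inner ℝ (X y) (D Y y (Z y)) := fun hy hX hY =>
    hD.metric.mvfderiv_inner_eq _ (hX.mdifferentiableAt hO hy) (hY.mdifferentiableAt hO hy)
  have md : ∀ {X Y : ∀ x : M, TangentSpace 𝓘(ℝ, E) x}, SmoothFieldOn X O → SmoothFieldOn Y O →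
      MDiffAt (fun y => inner ℝ (X y) (Y y)) x := fun hX hY =>
    ((hX.inner hY).contMDiffAt (hO.mem_nhds hx)).mdifferentiableAt (by simp)
  have e1 : ∀ {X : ∀ x : M, TangentSpace 𝓘(ℝ, E) x},
      (fun y => d% (fun y => inner ℝ (W y) (Z y)) y (X y)) =ᶠ[𝓝 x]
        fun y => inner ℝ (D W y (X y)) (Z y) + inner ℝ (W y) (D Z y (X y)) :=
    eventually_of_mem (hO.mem_nhds hx) fun y hy => d1 hy hW hZ
  have md1 : ∀ {X : ∀ x : M, TangentSpace 𝓘(ℝ, E) x}, SmoothFieldOn X O →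
      MDiffAt (fun y => d% (fun y => inner ℝ (W y) (Z y)) y (X y)) x := fun hX =>
    ((md (hX.cov hD.smooth hO hW) hZ).add (md hW (hX.cov hD.smooth hO hZ))).congr_of_eventuallyEq e1
  have d2 : ∀ {X Y : ∀ x : M, TangentSpace 𝓘(ℝ, E) x}, SmoothFieldOn X O →
      d% (fun y => d% (fun y => inner ℝ (W y) (Z y)) y (X y)) x (Y x) =
        inner ℝ (D (fun y => D W y (X y)) x (Y x)) (Z x) + inner ℝ (D W x (X x)) (D Z x (Y x)) +
        (inner ℝ (D W x (Y x)) (D Z x (X x)) +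
          inner ℝ (W x) (D (fun y => D Z y (X y)) x (Y x))) := by
    intro X Y hX
    have h1 : d% (fun y => d% (fun y => inner ℝ (W y) (Z y)) y (X y)) x =
        d% (fun y => inner ℝ (D W y (X y)) (Z y) + inner ℝ (W y) (D Z y (X y))) x := by
      exact mvfderiv_congr e1
    rw [h1, mvfderiv_fun_add (md (hX.cov hD.smooth hO hW) hZ) (md hW (hX.cov hD.smooth hO hZ)),
      add_apply, d1 hx (hX.cov hD.smooth hO hW) hZ, d1 hx hW (hX.cov hD.smooth hO hZ)]
  have h := mvfderiv_mvfderiv_sub hO hx hU hV (hW.inner hZ) (md1 hU) (md1 hV)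
  rw [d2 hV, d2 hU, d1 hx hW hZ] at h
  simp only [curvatureOf, inner_sub_left, inner_sub_right]
  linear_combination h

/-- The pair symmetry of the Riemann curvature tensor. It is the combination of the Bianchi
identities for the four triples out of `U, V, W, Z` in which all but the desired terms cancel by
skew-symmetry. -/
lemma inner_curvatureOf_comm (hD : IsLeviCivita D) (hO : IsOpen O) (hx : x ∈ O)
    (hU : SmoothFieldOn U O) (hV : SmoothFieldOn V O) (hW : SmoothFieldOn W O)
    (hZ : SmoothFieldOn Z O) :
    inner ℝ (curvatureOf D U V W x) (Z x) = inner ℝ (curvatureOf D W Z U x) (V x) := by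
  have B : ∀ {A B C F : ∀ x : M, TangentSpace 𝓘(ℝ, E) x}, SmoothFieldOn A O → SmoothFieldOn B O →
      SmoothFieldOn C O → inner ℝ (curvatureOf D A B C x) (F x) +
        inner ℝ (curvatureOf D B C A x) (F x) + inner ℝ (curvatureOf D C A B x) (F x) = 0 := by
    intro A B C F hA hB hC
    rw [← inner_add_left, ← inner_add_left,
      curvatureOf_bianchi hD.smooth hD.torsion_free hO hx hA hB hC, inner_zero_left]
  have S : ∀ {A B C F : ∀ x : M, TangentSpace 𝓘(ℝ, E) x}, SmoothFieldOn A O → SmoothFieldOn B O →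
      SmoothFieldOn C O → SmoothFieldOn F O → inner ℝ (curvatureOf D A B C x) (F x) +
        inner ℝ (curvatureOf D A B F x) (C x) = 0 := by
    intro A B C F hA hB hC hF
    rw [real_inner_comm (C x)]
    exact inner_curvatureOf_add hD hO hx hA hB hC hF
  have K : ∀ {A B C F : ∀ x : M, TangentSpace 𝓘(ℝ, E) x},
      inner ℝ (curvatureOf D A B C x) (F x) = -inner ℝ (curvatureOf D B A C x) (F x) := by
    intro A B C F
    rw [curvatureOf_swap, inner_neg_left]
  have b1 := B (F := Z) hU hV hW
  have b2 := B (F := U) hV hW hZ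
  have b3 := B (F := V) hW hZ hU
  have b4 := B (F := W) hZ hU hV
  have s1 := S hU hV hW hZ
  have s2 := S hV hW hU hZ
  have s3 := S hW hZ hU hV
  have s4 := S hZ hU hV hW
  have s5 := S hW hU hV hZ
  have s6 := S hV hZ hU hW
  have k1 := K (A := W) (B := U) (C := Z) (F := V)
  have k2 := K (A := Z) (B := V) (C := W) (F := U)
  have k3 := K (A := V) (B := Z) (C := U) (F := W)
  have k4 := K (A := U) (B := W) (C := Z) (F := V)
  linarith

/-- In a space of constant curvature `c`, `R(u, v) v = c (|v|² u - ⟨u, v⟩ v)`: the form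
`⟨R(u, v) v, w⟩` is symmetric in `u` and `w`, so it is determined by the sectional curvatures. -/
theorem curvatureTensor_of_hasConstantCurvature (hD : IsLeviCivita D) {c : ℝ}
    (hc : HasConstantCurvature D c) (u v : TangentSpace 𝓘(ℝ, E) x) :
    curvatureTensor D x u v v = c • (‖v‖ ^ 2 • u - (inner ℝ u v : ℝ) • v) := by
  have := isManifold_minSmoothness (E := E) (M := M) 2
  let O := (trivializationAt E (TangentSpace 𝓘(ℝ, E)) x).baseSet
  have hO : IsOpen O := (trivializationAt E (TangentSpace 𝓘(ℝ, E)) x).open_baseSet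
  have hx : x ∈ O := FiberBundle.mem_baseSet_trivializationAt E (TangentSpace 𝓘(ℝ, E)) x
  have hext (w : TangentSpace 𝓘(ℝ, E) x) : SmoothFieldOn (FiberBundle.extend E w) O := by
    refine ((trivializationAt E (TangentSpace 𝓘(ℝ, E)) x).contMDiffOn_section_baseSet_iff).2 ?_
    refine (contMDiffOn_const
      (c := (trivializationAt E (TangentSpace 𝓘(ℝ, E)) x ⟨x, w⟩).2)).congr fun y hy => ?_
    rw [FiberBundle.extend, Trivialization.apply_mk_symm _ hy]
  have hR (a b w : TangentSpace 𝓘(ℝ, E) x) : curvatureTensor D x a b w = curvatureOf D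
      (FiberBundle.extend E a) (FiberBundle.extend E b) (FiberBundle.extend E w) x := rfl
  have hsymm (a b : TangentSpace 𝓘(ℝ, E) x) : inner ℝ (curvatureTensor D x a v v) b =
      inner ℝ (curvatureTensor D x b v v) a := by
    have h1 := inner_curvatureOf_comm hD hO hx (hext a) (hext v) (hext v) (hext b)
    have h2 := inner_curvatureOf_add hD hO hx (hext v) (hext b) (hext a) (hext v)
    rw [curvatureOf_swap (U := FiberBundle.extend E b) (W := FiberBundle.extend E v),
      inner_neg_right] at h2
    simp only [FiberBundle.extend_apply_self] at h1 h2
    rw [hR, hR, h1, real_inner_comm a]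
    linarith
  have hadd (a b : TangentSpace 𝓘(ℝ, E) x) : curvatureTensor D x (a + b) v v =
      curvatureTensor D x a v v + curvatureTensor D x b v v := by
    have h0 := extend_add_eventuallyEq a b
    have hc (w : TangentSpace 𝓘(ℝ, E) x) := (hext w).cov hD.smooth hO (hext v)
    have h1 : D (fun y => D (FiberBundle.extend E v) y (FiberBundle.extend E (a + b) y)) x =
        D ((fun y => D (FiberBundle.extend E v) y (FiberBundle.extend E a y)) +
          fun y => D (FiberBundle.extend E v) y (FiberBundle.extend E b y)) x :=
      D.isCovariantDerivativeOnUniv.congr_of_eventuallyEq ((hc _).mdifferentiableAt hO hx)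
        (mdifferentiableAt_add_section ((hc a).mdifferentiableAt hO hx)
          ((hc b).mdifferentiableAt hO hx)) univ_mem
        (h0.mono fun y hy => by simp only [hy, map_add, Pi.add_apply])
    have h2 : mlieBracket 𝓘(ℝ, E) (FiberBundle.extend E (a + b)) (FiberBundle.extend E v) x =
        mlieBracket 𝓘(ℝ, E) (FiberBundle.extend E a + FiberBundle.extend E b)
          (FiberBundle.extend E v) x :=
      EventuallyEq.mlieBracket_vectorField_eq h0 EventuallyEq.rfl
    rw [hR, hR, hR, curvatureOf, curvatureOf, curvatureOf, h1, h2,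
      D.isCovariantDerivativeOnUniv.add ((hc a).mdifferentiableAt hO hx)
        ((hc b).mdifferentiableAt hO hx),
      mlieBracket_add_left ((hext a).mdifferentiableAt hO hx) ((hext b).mdifferentiableAt hO hx)]
    simp only [FiberBundle.extend_apply_self, map_add, add_apply]
    abel
  refine ext_inner_right ℝ fun w => ?_
  have h1 := hc x (u + w) v
  rw [hadd, inner_add_left, inner_add_right, inner_add_right, hc x u v, hc x w v, hsymm w u] at h1
  have h2 := norm_add_sq_real u w
  simp only [real_inner_smul_left, inner_sub_left]
  rw [inner_add_left, h2] at h1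
  rw [real_inner_comm w v]
  linarith

end SectionalCurvature

/-! ### Gluing of sections determined up to sign -/

section Gluing

/-- Local sections over `ℝ` which are determined up to sign: `P β t` says that `β` is an admissible
section near `t`. Every point of `s` has an admissible section near it, and two of them agree near
the point up to sign. -/
structure TwoValuedGerms {X : ℝ → Type*} [∀ t, InvolutiveNeg (X t)]
    (P : (∀ t, X t) → ℝ → Prop) (s : Set ℝ) : Prop where
  congr : ∀ {β β' : ∀ t, X t} {t : ℝ}, P β t → (∀ᶠ r in 𝓝 t, β' r = β r) → P β' t
  eventually : ∀ {β : ∀ t, X t} {t : ℝ}, P β t → ∀ᶠ r in 𝓝 t, P β r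
  neg : ∀ {β : ∀ t, X t} {t : ℝ}, P β t → P (fun r => -β r) t
  ne_neg : ∀ {β : ∀ t, X t} {t : ℝ}, P β t → β t ≠ -β t
  unique : ∀ {β β' : ∀ t, X t} {t : ℝ}, P β t → P β' t →
    (∀ᶠ r in 𝓝 t, β r = β' r) ∨ ∀ᶠ r in 𝓝 t, β r = -β' r
  exists_germ : ∀ t ∈ s, ∃ β, P β t

namespace TwoValuedGerms

variable {X : ℝ → Type*} [∀ t, InvolutiveNeg (X t)] {P : (∀ t, X t) → ℝ → Prop} {s : Set ℝ}
  {β β' : ∀ t, X t} {t : ℝ}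

lemma eventuallyEq_of_eq (h : TwoValuedGerms P s) (hβ : P β t) (hβ' : P β' t) (he : β t = β' t) :
    ∀ᶠ r in 𝓝 t, β r = β' r :=
  (h.unique hβ hβ').resolve_right fun hn =>
    h.ne_neg hβ' (he.symm.trans hn.self_of_nhds)

/-- Admissible sections over an interval which agree at one point agree. -/
lemma eq_of_eq (h : TwoValuedGerms P s) {a b : ℝ} (hβ : ∀ r ∈ uIcc a b, P β r)
    (hβ' : ∀ r ∈ uIcc a b, P β' r) (he : β a = β' a) : β b = β' b := by
  have key : β a = β' a → β b = β' b := by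
    refine isPreconnected_uIcc.induction₂' (fun x y => β x = β' x → β y = β' y) ?_
      (fun _ _ _ _ _ _ h1 h2 h3 => h2 (h1 h3)) left_mem_uIcc right_mem_uIcc
    intro x hx
    refine Filter.Eventually.filter_mono nhdsWithin_le_nhds ?_
    have h0 : ∀ᶠ r in 𝓝 x, (β x = β' x ∧ β r = β' r) ∨ (β x = -β' x ∧ β r = -β' r) := by
      rcases h.unique (hβ x hx) (hβ' x hx) with h1 | h1
      · exact h1.mono fun r hr => Or.inl ⟨h1.self_of_nhds, hr⟩
      · exact h1.mono fun r hr => Or.inr ⟨h1.self_of_nhds, hr⟩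
    filter_upwards [h.eventually (hβ' x hx), h0] with r hr hr'
    rcases hr' with ⟨h1, h2⟩ | ⟨h1, h2⟩
    · exact ⟨fun _ => h2, fun _ => h1⟩
    · exact ⟨fun h3 => (h.ne_neg (hβ' x hx) (h3.symm.trans h1)).elim,
        fun h3 => (h.ne_neg hr (h3.symm.trans h2)).elim⟩
  exact key he

lemma exists_eq (h : TwoValuedGerms P s) {K : Set ℝ} (hβ : ∀ r ∈ K, P β r) (ht : t ∈ K)
    (hβ' : P β' t) : ∃ β'', (∀ r ∈ K, P β'' r) ∧ β'' t = β' t := by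
  rcases h.unique hβ' (hβ t ht) with h1 | h1
  · exact ⟨β, hβ, h1.self_of_nhds.symm⟩
  · exact ⟨fun r => -β r, fun r hr => h.neg (hβ r hr), h1.self_of_nhds.symm⟩

lemma exists_Icc_trans (h : TwoValuedGerms P s) {a b c : ℝ} (hab : a ≤ b) (hbc : b ≤ c)
    (h1 : ∃ β, ∀ r ∈ Icc a b, P β r) (h2 : ∃ β, ∀ r ∈ Icc b c, P β r) :
    ∃ β, ∀ r ∈ Icc a c, P β r := by
  obtain ⟨β, hβ⟩ := h1
  obtain ⟨β', hβ'⟩ := h2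
  obtain ⟨β', hβ', he⟩ := h.exists_eq hβ' (left_mem_Icc.2 hbc) (hβ b (right_mem_Icc.2 hab))
  have he' := h.eventuallyEq_of_eq (hβ' b (left_mem_Icc.2 hbc)) (hβ b (right_mem_Icc.2 hab)) he
  refine ⟨fun r => if r ≤ b then β r else β' r, fun r hr => ?_⟩
  rcases lt_trichotomy r b with hrb | rfl | hrb
  · exact h.congr (hβ r ⟨hr.1, hrb.le⟩) ((eventually_lt_nhds hrb).mono fun z hz => if_pos hz.le)
  · refine h.congr (hβ r ⟨hr.1, le_rfl⟩) (he'.mono fun z hz => ?_)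
    split_ifs
    exacts [rfl, hz]
  · exact h.congr (hβ' r ⟨hrb.le, hr.2⟩)
      ((eventually_gt_nhds hrb).mono fun z hz => if_neg (not_le.2 hz))

lemma exists_uIcc (h : TwoValuedGerms P s) (hs : s.OrdConnected) {a b : ℝ} (ha : a ∈ s)
    (hb : b ∈ s) : ∃ β, ∀ r ∈ uIcc a b, P β r := by
  refine hs.isPreconnected.induction₂ (fun x y => ∃ β, ∀ r ∈ uIcc x y, P β r) ?_ ?_ ?_ ha hb
  · intro x hx
    obtain ⟨β, hβ⟩ := h.exists_germ x hx
    obtain ⟨ε, hε, hb⟩ := Metric.eventually_nhds_iff_ball.1 (h.eventually hβ)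
    refine Filter.Eventually.filter_mono nhdsWithin_le_nhds ?_
    filter_upwards [Metric.ball_mem_nhds x hε] with y hy
    exact ⟨β, fun r hr => hb r (((convex_ball x ε).ordConnected.uIcc_subset
      (Metric.mem_ball_self hε) hy) hr)⟩
  · intro x y z _ _ _ h1 h2
    have mono : ∀ {u v : Set ℝ}, u ⊆ v → (∃ β, ∀ r ∈ v, P β r) → ∃ β, ∀ r ∈ u, P β r :=
      fun huv ⟨β, hβ⟩ => ⟨β, fun r hr => hβ r (huv hr)⟩
    rcases le_total x y with hxy | hxy <;> rcases le_total y z with hyz | hyz <;>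
      rcases le_total x z with hxz | hxz <;>
      simp only [uIcc_of_le, uIcc_of_ge, hxy, hyz, hxz] at h1 h2 ⊢
    · exact h.exists_Icc_trans hxy hyz h1 h2
    · exact mono (Icc_subset_Icc (by linarith) (by linarith)) h1
    · exact mono (Icc_subset_Icc (by linarith) (by linarith)) h1
    · exact mono (Icc_subset_Icc (by linarith) (by linarith)) h2
    · exact mono (Icc_subset_Icc (by linarith) (by linarith)) h2
    · exact mono (Icc_subset_Icc (by linarith) (by linarith)) h1
    · exact mono (Icc_subset_Icc (by linarith) (by linarith)) h1
    · exact h.exists_Icc_trans hyz hxy h2 h1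
  · intro x y _ _ h1
    rwa [uIcc_comm]

/-- Sections determined up to sign exist globally over an interval. -/
theorem exists_global (h : TwoValuedGerms P s) (ho : IsOpen s) (hs : s.OrdConnected)
    (hne : s.Nonempty) :
    ∃ β, ∀ t ∈ s, P β t := by
  obtain ⟨a, ha⟩ := hne
  obtain ⟨β₀, hβ₀⟩ := h.exists_germ a ha
  have h1 (t : ℝ) : ∃ β, t ∈ s → (∀ r ∈ uIcc a t, P β r) ∧ β a = β₀ a := by
    by_cases ht : t ∈ s
    · obtain ⟨β, hβ⟩ := h.exists_uIcc hs ha ht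
      obtain ⟨β', hβ'⟩ := h.exists_eq hβ left_mem_uIcc hβ₀
      exact ⟨β', fun _ => hβ'⟩
    · exact ⟨β₀, fun h => (ht h).elim⟩
  -- The sections over the intervals from `a` to `t`, normalized at `a`, agree near their ends `t`.
  choose β hβ using h1
  refine ⟨fun t => β t t, fun t ht => ?_⟩
  obtain ⟨h2, h3⟩ := hβ t ht
  obtain ⟨ε, hε, hb⟩ := Metric.eventually_nhds_iff_ball.1 (h.eventually (h2 t right_mem_uIcc))
  refine h.congr (h2 t right_mem_uIcc) ?_
  filter_upwards [Metric.ball_mem_nhds t hε, ho.mem_nhds ht] with r hr hrs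
  obtain ⟨h4, h5⟩ := hβ r hrs
  refine h.eq_of_eq h4 (fun z hz => ?_) (h5.trans h3.symm)
  rcases uIcc_subset_uIcc_union_uIcc (b := t) hz with hz | hz
  · exact h2 z hz
  · exact hb z ((convex_ball t ε).ordConnected.uIcc_subset (Metric.mem_ball_self hε) hr hz)

end TwoValuedGerms

end Gluing

/-! ### Orthonormal frames in dimension three -/

section Orthonormal

variable {F : Type*} [NormedAddCommGroup F] [InnerProductSpace ℝ F] {u v w w' : F}

lemma orthonormal_pair_iff :
    Orthonormal ℝ ![u, v] ↔ ‖u‖ = 1 ∧ ‖v‖ = 1 ∧ inner ℝ u v = 0 := by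
  simp only [orthonormal_vecCons_iff, Fin.forall_fin_succ]
  simp
  tauto

lemma orthonormal_triple_iff : Orthonormal ℝ ![u, v, w] ↔
    Orthonormal ℝ ![u, v] ∧ ‖w‖ = 1 ∧ inner ℝ u w = 0 ∧ inner ℝ v w = 0 := by
  simp only [orthonormal_vecCons_iff, Fin.forall_fin_succ]
  simp
  tauto

lemma eq_sum_of_orthonormal (hF : Module.finrank ℝ F = 3) (h : Orthonormal ℝ ![u, v, w]) (x : F) :
    x = (inner ℝ u x : ℝ) • u + (inner ℝ v x : ℝ) • v + (inner ℝ w x : ℝ) • w := by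
  have : FiniteDimensional ℝ F := Module.finite_of_finrank_pos (by omega)
  let b := (basisOfOrthonormalOfCardEqFinrank h (by simp [hF])).toOrthonormalBasis
    (by simpa using h)
  have hb := b.sum_repr' x
  simp only [Fin.sum_univ_three] at hb
  simpa [b] using hb.symm

/-- In dimension three the unit normal to a plane is determined up to sign, and the sign is read off
from an inner product. -/
lemma eq_or_eq_neg_of_orthonormal (hF : Module.finrank ℝ F = 3) (h : Orthonormal ℝ ![u, v, w])
    (h' : Orthonormal ℝ ![u, v, w']) :
    (inner ℝ w w' = (1 : ℝ) ∧ w' = w) ∨ (inner ℝ w w' = (-1 : ℝ) ∧ w' = -w) := by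
  have h1 := eq_sum_of_orthonormal hF h w'
  obtain ⟨-, h2, h3, h4⟩ := orthonormal_triple_iff.1 h'
  obtain ⟨-, h5, -, -⟩ := orthonormal_triple_iff.1 h
  rw [h3, h4, zero_smul, zero_smul, zero_add, zero_add] at h1
  have h6 : |(inner ℝ w w' : ℝ)| = 1 := by
    rw [h1, norm_smul, h5, mul_one, Real.norm_eq_abs] at h2
    exact h2
  rcases eq_or_eq_neg_of_abs_eq h6 with h7 | h7
  · exact Or.inl ⟨h7, by rw [h1, h7, one_smul]⟩
  · exact Or.inr ⟨h7, by rw [h1, h7, neg_smul, one_smul]⟩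

lemma exists_orthonormal_triple (hF : Module.finrank ℝ F = 3) (h : Orthonormal ℝ ![u, v]) :
    ∃ w, Orthonormal ℝ ![u, v, w] := by
  have : FiniteDimensional ℝ F := Module.finite_of_finrank_pos (by omega)
  obtain ⟨b, hb⟩ := Orthonormal.exists_orthonormalBasis_extension_of_card_eq (𝕜 := ℝ)
    (ι := Fin 3) (by simp [hF]) (v := ![u, v, 0]) (s := {0, 1}) (by
      have e : ({0, 1} : Set (Fin 3)).domRestrict ![u, v, 0] = ![u, v] ∘
          fun i : ({0, 1} : Set (Fin 3)) => if i.1 = 0 then 0 else 1 := by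
        ext ⟨i, hi⟩
        rcases hi with rfl | rfl <;> simp [Set.domRestrict]
      rw [e]
      refine h.comp _ ?_
      rintro ⟨i, hi⟩ ⟨j, hj⟩
      rcases hi with rfl | rfl <;> rcases hj with rfl | rfl <;> simp)
  refine ⟨b 2, ?_⟩
  have h0 := hb 0 (by simp)
  have h1 := hb 1 (by simp)
  simp only [Matrix.cons_val_zero, Matrix.cons_val_one] at h0 h1
  convert b.orthonormal using 1
  ext i
  fin_cases i <;> simp [h0, h1]

end Orthonormal

section Binormal

variable {E : Type*} [NormedAddCommGroup E] [NormedSpace ℝ E]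
  {M : Type*} [TopologicalSpace M] [ChartedSpace E M] [IsManifold 𝓘(ℝ, E) ∞ M]
  [RiemannianBundle (fun x : M => TangentSpace 𝓘(ℝ, E) x)]
  [IsContMDiffRiemannianBundle 𝓘(ℝ, E) ∞ E (fun x : M => TangentSpace 𝓘(ℝ, E) x)]
  {γ : ℝ → M} {T N : ∀ t, TangentSpace 𝓘(ℝ, E) (γ t)} {s : Set ℝ}

/-- The field `B` is smooth near `t` and completes `T, N` to an orthonormal frame there. -/
def IsBinormalAt (T N B : ∀ t, TangentSpace 𝓘(ℝ, E) (γ t)) (t : ℝ) : Prop :=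
  ∃ u : Set ℝ, IsOpen u ∧ t ∈ u ∧ SmoothAlongOn B u ∧ ∀ r ∈ u, Orthonormal ℝ ![T r, N r, B r]

lemma exists_isBinormalAt (hE : Module.finrank ℝ E = 3) (hs : IsOpen s)
    (hγ : ContMDiffOn 𝓘(ℝ, ℝ) 𝓘(ℝ, E) ∞ γ s) (hT : SmoothAlongOn T s) (hN : SmoothAlongOn N s)
    (h : ∀ t ∈ s, Orthonormal ℝ ![T t, N t]) {t : ℝ} (ht : t ∈ s) :
    ∃ B, IsBinormalAt T N B t := by
  obtain ⟨w, hw⟩ := exists_orthonormal_triple (F := TangentSpace 𝓘(ℝ, E) (γ t)) hE (h t ht)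
  obtain ⟨hw0, hw1, hw2, hw3⟩ := orthonormal_triple_iff.1 hw
  obtain ⟨U, hU, htU, hX⟩ : ∃ U : Set M, IsOpen U ∧ γ t ∈ U ∧
      ContMDiffOn 𝓘(ℝ, E) 𝓘(ℝ, E).tangent ∞
        (fun x => (⟨x, FiberBundle.extend E w x⟩ : TangentBundle 𝓘(ℝ, E) M)) U := by
    obtain ⟨O, hO, hX⟩ := FiberBundle.exists_contMDiffOn_extend (k := ∞) 𝓘(ℝ, E) E w
    obtain ⟨U, hUO, hU, htU⟩ := mem_nhds_iff.1 hO
    exact ⟨U, hU, htU, hX.mono hUO⟩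
  set s₁ := s ∩ γ ⁻¹' U
  have hs₁ : IsOpen s₁ := hγ.continuousOn.isOpen_inter_preimage hs hU
  have hX₁ := smoothAlongOn_comp hX (hγ.mono inter_subset_left) (s := s₁) fun r hr => hr.2
  have hT₁ : SmoothAlongOn T s₁ := ContMDiffOn.mono hT inter_subset_left
  have hN₁ : SmoothAlongOn N s₁ := ContMDiffOn.mono hN inter_subset_left
  -- Extend `w` by constant components and apply the Gram-Schmidt process to `T, N, X`.
  let X : ∀ r, TangentSpace 𝓘(ℝ, E) (γ r) := fun r => FiberBundle.extend E w (γ r)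
  let Y : ∀ r, TangentSpace 𝓘(ℝ, E) (γ r) := fun r =>
    X r + ((-inner ℝ (T r) (X r) : ℝ) • T r + (-inner ℝ (N r) (X r) : ℝ) • N r)
  have hY : SmoothAlongOn Y s₁ :=
    hX₁.add hs₁ ((hT₁.smul hs₁ (hT₁.contDiffOn_inner hX₁).neg).add hs₁
      (hN₁.smul hs₁ (hN₁.contDiffOn_inner hX₁).neg))
  have hYY := hY.contDiffOn_inner hY
  have hYt : Y t = w := by
    simp only [Y, X, FiberBundle.extend_apply_self, hw2, hw3]
    simp
  refine ⟨fun r => (√(inner ℝ (Y r) (Y r)))⁻¹ • Y r,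
    s₁ ∩ (fun r => inner ℝ (Y r) (Y r)) ⁻¹' Ioi (0 : ℝ),
    hYY.continuousOn.isOpen_inter_preimage hs₁ isOpen_Ioi, ⟨⟨ht, htU⟩, ?_⟩, ?_, ?_⟩
  · simp [hYt, hw1]
  · have ho := hYY.continuousOn.isOpen_inter_preimage hs₁ (isOpen_Ioi (a := (0 : ℝ)))
    refine SmoothAlongOn.smul ho (ContDiffOn.inv (ContDiffOn.sqrt
      (hYY.mono inter_subset_left) fun r hr => ?_) fun r hr => ?_)
      (ContMDiffOn.mono hY inter_subset_left)
    · exact (show (0 : ℝ) < _ from hr.2).ne'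
    · exact (Real.sqrt_pos.2 hr.2).ne'
  · intro r hr
    have hr0 := h r hr.1.1
    obtain ⟨h1, h2, h3⟩ := orthonormal_pair_iff.1 hr0
    have hpos : (0 : ℝ) < √(inner ℝ (Y r) (Y r)) := Real.sqrt_pos.2 hr.2
    have hTY : inner ℝ (T r) (Y r) = (0 : ℝ) := by
      simp [Y, inner_add_right, real_inner_smul_right, h1, h3]
    have hNY : inner ℝ (N r) (Y r) = (0 : ℝ) := by
      simp [Y, inner_add_right, real_inner_smul_right, h2, real_inner_comm (T r) (N r), h3]
    refine orthonormal_triple_iff.2 ⟨hr0, ?_, ?_, ?_⟩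
    · rw [norm_smul, norm_inv, Real.norm_of_nonneg hpos.le, ← norm_eq_sqrt_real_inner]
      refine inv_mul_cancel₀ ?_
      rw [norm_eq_sqrt_real_inner]
      exact hpos.ne'
    · rw [real_inner_smul_right, hTY, mul_zero]
    · rw [real_inner_smul_right, hNY, mul_zero]

lemma twoValuedGerms_isBinormalAt (hE : Module.finrank ℝ E = 3) (hs : IsOpen s)
    (hγ : ContMDiffOn 𝓘(ℝ, ℝ) 𝓘(ℝ, E) ∞ γ s) (hT : SmoothAlongOn T s) (hN : SmoothAlongOn N s)
    (h : ∀ t ∈ s, Orthonormal ℝ ![T t, N t]) :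
    TwoValuedGerms (X := fun t => TangentSpace 𝓘(ℝ, E) (γ t)) (IsBinormalAt T N) s where
  congr := by
    rintro β β' t ⟨u, hu, ht, h1, h2⟩ he
    obtain ⟨v, hv, hvo, htv⟩ := eventually_nhds_iff.1 he
    refine ⟨u ∩ v, hu.inter hvo, ⟨ht, htv⟩,
      SmoothAlongOn.congr (ContMDiffOn.mono h1 inter_subset_left) fun r hr => hv r hr.2,
      fun r hr => ?_⟩
    rw [hv r hr.2]
    exact h2 r hr.1
  eventually := by
    rintro β t ⟨u, hu, ht, h1, h2⟩
    filter_upwards [hu.mem_nhds ht] with r hr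
    exact ⟨u, hu, hr, h1, h2⟩
  neg := by
    rintro β t ⟨u, hu, ht, h1, h2⟩
    refine ⟨u, hu, ht, (h1.smul hu (contDiffOn_const (c := (-1 : ℝ)))).congr fun r hr => by simp,
      fun r hr => ?_⟩
    obtain ⟨h3, h4, h5, h6⟩ := orthonormal_triple_iff.1 (h2 r hr)
    exact orthonormal_triple_iff.2 ⟨h3, by rw [norm_neg, h4], by rw [inner_neg_right, h5, neg_zero],
      by rw [inner_neg_right, h6, neg_zero]⟩
  ne_neg := by
    rintro β t ⟨u, hu, ht, h1, h2⟩ he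
    have h4 := (orthonormal_triple_iff.1 (h2 t ht)).2.1
    have h5 : (2 : ℝ) • β t = 0 := by linear_combination (norm := module) he
    rw [(smul_eq_zero.1 h5).resolve_left two_ne_zero, norm_zero] at h4
    exact zero_ne_one h4
  unique := by
    rintro β β' t ⟨u, hu, ht, h1, h2⟩ ⟨u', hu', ht', h1', h2'⟩
    have hd (r : ℝ) (hr : r ∈ u) (hr' : r ∈ u') :=
      eq_or_eq_neg_of_orthonormal (F := TangentSpace 𝓘(ℝ, E) (γ r)) hE (h2' r hr') (h2 r hr)
    have hc : ContinuousAt (fun r => (inner ℝ (β' r) (β r) : ℝ)) t :=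
      ((h1'.diffAlongAt hu' ht').differentiableAt_inner (h1.diffAlongAt hu ht)).continuousAt
    rcases hd t ht ht' with ⟨h3, -⟩ | ⟨h3, -⟩
    · left
      filter_upwards [hc.eventually (lt_mem_nhds
        (show (0 : ℝ) < inner ℝ (β' t) (β t) by simp [h3])),
        hu.mem_nhds ht, hu'.mem_nhds ht'] with r hr hr1 hr2
      rcases hd r hr1 hr2 with ⟨h4, h5⟩ | ⟨h4, h5⟩
      · exact h5
      · rw [h4] at hr
        norm_num at hr
    · right
      filter_upwards [hc.eventually (gt_mem_nhds
        (show inner ℝ (β' t) (β t) < (0 : ℝ) by simp [h3])),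
        hu.mem_nhds ht, hu'.mem_nhds ht'] with r hr hr1 hr2
      rcases hd r hr1 hr2 with ⟨h4, h5⟩ | ⟨h4, h5⟩
      · rw [h4] at hr
        norm_num at hr
      · exact h5
  exists_germ t ht := exists_isBinormalAt hE hs hγ hT hN h ht

/-- An orthonormal pair of smooth fields along a curve in a three-dimensional manifold can be
completed to a smooth orthonormal frame. No orientation is needed, as the parameter runs through an
interval. -/
theorem exists_binormal (hE : Module.finrank ℝ E = 3) (hs : IsOpen s) (hs' : s.OrdConnected)
    (hne : s.Nonempty)
    (hγ : ContMDiffOn 𝓘(ℝ, ℝ) 𝓘(ℝ, E) ∞ γ s) (hT : SmoothAlongOn T s) (hN : SmoothAlongOn N s)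
    (h : ∀ t ∈ s, Orthonormal ℝ ![T t, N t]) :
    ∃ B : ∀ t, TangentSpace 𝓘(ℝ, E) (γ t), SmoothAlongOn B s ∧
      ∀ t ∈ s, Orthonormal ℝ ![T t, N t, B t] := by
  obtain ⟨B, hB⟩ := (twoValuedGerms_isBinormalAt hE hs hγ hT hN h).exists_global hs hs' hne
  refine ⟨B, (smoothAlongOn_iff hs).2 fun t ht => ?_, fun t ht => ?_⟩
  · obtain ⟨u, hu, htu, h1, -⟩ := hB t ht
    exact (smoothAlongOn_iff hu).1 h1 t htu
  · obtain ⟨u, hu, htu, -, h1⟩ := hB t ht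
    exact h1 t htu

end Binormal

/-! ### The tension fields of unit speed curves -/

section Tension

variable {E : Type*} [NormedAddCommGroup E] [NormedSpace ℝ E]
  {M : Type*} [TopologicalSpace M] [ChartedSpace E M] [IsManifold 𝓘(ℝ, E) ∞ M]
  [RiemannianBundle (fun x : M => TangentSpace 𝓘(ℝ, E) x)]
  {D : CovariantDerivative 𝓘(ℝ, E) E (TangentSpace 𝓘(ℝ, E) : M → Type _)}
  {γ : ℝ → M} {V W : ∀ t, TangentSpace 𝓘(ℝ, E) (γ t)} {s : Set ℝ} {t c k : ℝ}

/-- The curvature vector `∇_T T` of the curve `γ` with velocity `T`. -/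
noncomputable def curvatureVector
    (D : CovariantDerivative 𝓘(ℝ, E) E (TangentSpace 𝓘(ℝ, E) : M → Type _)) (γ : ℝ → M) (t : ℝ) :
    TangentSpace 𝓘(ℝ, E) (γ t) :=
  covDerivAlong D γ (velocity γ) t

lemma pTension_eq (hs : IsOpen s) (hu : ∀ t ∈ s, ‖velocity (E := E) γ t‖ = 1) (p : ℝ)
    (ht : t ∈ s) : pTension D p γ t = curvatureVector D γ t :=
  covDerivAlong_congr (eventually_of_mem (hs.mem_nhds ht) fun r hr => by
    rw [hu r hr, Real.one_rpow, one_smul])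

lemma pqField_eq (hs : IsOpen s) (hu : ∀ t ∈ s, ‖velocity (E := E) γ t‖ = 1) (p q : ℝ)
    (ht : t ∈ s) :
    pqField D p q γ t = ‖curvatureVector D γ t‖ ^ (q - 2) • curvatureVector D γ t := by
  rw [pqField, pTension_eq hs hu p ht]

lemma pqFlux₁_eq (hu : ∀ t ∈ s, ‖velocity (E := E) γ t‖ = 1) (p q : ℝ)
    (ht : t ∈ s) : pqFlux₁ D p q γ t = covDerivAlong D γ (pqField D p q γ) t := by
  rw [pqFlux₁, hu t ht, Real.one_rpow, one_smul]

variable [FiniteDimensional ℝ E]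
  [IsContMDiffRiemannianBundle 𝓘(ℝ, E) ∞ E (fun x : M => TangentSpace 𝓘(ℝ, E) x)]

lemma inner_covDerivAlong_add_eq_zero (hD : IsLeviCivita D) (hs : IsOpen s) (ht : t ∈ s)
    (hV : DiffAlongAt V t) (hW : DiffAlongAt W t) (h : ∀ r ∈ s, inner ℝ (V r) (W r) = k) :
    inner ℝ (covDerivAlong D γ V t) (W t) + inner ℝ (V t) (covDerivAlong D γ W t) = (0 : ℝ) :=
  (hasDerivAt_inner_along hD.metric hV hW).unique ((hasDerivAt_const t k).congr_of_eventuallyEq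
    (eventually_of_mem (hs.mem_nhds ht) h))

lemma inner_curvatureVector_velocity (hD : IsLeviCivita D) (hs : IsOpen s)
    (hγ : ContMDiffOn 𝓘(ℝ, ℝ) 𝓘(ℝ, E) ∞ γ s) (hu : ∀ t ∈ s, ‖velocity (E := E) γ t‖ = 1)
    (ht : t ∈ s) : inner ℝ (curvatureVector D γ t) (velocity (E := E) γ t) = (0 : ℝ) := by
  have hT := (smoothAlongOn_velocity hs hγ).diffAlongAt hs ht
  have h := inner_covDerivAlong_add_eq_zero (k := 1) hD hs ht hT hT fun r hr => by
    rw [real_inner_self_eq_norm_sq, hu r hr, one_pow]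
  rw [real_inner_comm (velocity (E := E) γ t) (covDerivAlong D γ (velocity γ) t)] at h
  rw [curvatureVector]
  linarith [real_inner_comm (velocity (E := E) γ t) (covDerivAlong D γ (velocity γ) t)]

/-- As `V = |τ_p|^(q-2) τ_p` is normal to the curve, the tangential component of its derivative is
`-⟨V, ∇_T T⟩ = -|∇_T T|^q`. The exponents are kept separate, so that the formula also makes sense
as `0 = 0` at the zeros of `∇_T T`. -/
lemma pqFlux₂_eq (hD : IsLeviCivita D) (hs : IsOpen s)
    (hγ : ContMDiffOn 𝓘(ℝ, ℝ) 𝓘(ℝ, E) ∞ γ s) (hu : ∀ t ∈ s, ‖velocity (E := E) γ t‖ = 1)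
    {p q : ℝ} (ht : t ∈ s) (hV : DiffAlongAt (pqField D p q γ) t) :
    inner ℝ (covDerivAlong D γ (pqField D p q γ) t) (velocity (E := E) γ t) =
        -(‖curvatureVector D γ t‖ ^ (q - 2) * ‖curvatureVector D γ t‖ ^ 2) ∧
      pqFlux₂ D p q γ t = -(‖curvatureVector D γ t‖ ^ (q - 2) * ‖curvatureVector D γ t‖ ^ 2) •
        velocity γ t := by
  have hT := (smoothAlongOn_velocity hs hγ).diffAlongAt hs ht
  have h := inner_covDerivAlong_add_eq_zero (k := 0) hD hs ht hV hT fun r hr => by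
    rw [pqField_eq hs hu p q hr, real_inner_smul_left,
      inner_curvatureVector_velocity hD hs hγ hu hr, mul_zero]
  rw [pqField_eq hs hu p q ht, real_inner_smul_left, ← curvatureVector,
    real_inner_self_eq_norm_sq] at h
  have h1 := eq_neg_of_add_eq_zero_left h
  exact ⟨h1, by rw [pqFlux₂, hu t ht, Real.one_rpow, one_mul, h1]⟩

variable [T2Space M]

lemma smoothAlongOn_curvatureVector (hD : IsLeviCivita D) (hs : IsOpen s)
    (hγ : ContMDiffOn 𝓘(ℝ, ℝ) 𝓘(ℝ, E) ∞ γ s) : SmoothAlongOn (curvatureVector D γ) s :=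
  (smoothAlongOn_velocity hs hγ).covDerivAlong hD.smooth hs hγ

/-- For a unit speed curve in a space of constant curvature `c`, the curvature term of the
`(p,q)`-tension field is a multiple of `∇_T T`, as `∇_T T` is normal to `T`. -/
lemma pqTension_eq (hD : IsLeviCivita D) (hc : HasConstantCurvature D c) (hs : IsOpen s)
    (hγ : ContMDiffOn 𝓘(ℝ, ℝ) 𝓘(ℝ, E) ∞ γ s) (hu : ∀ t ∈ s, ‖velocity (E := E) γ t‖ = 1)
    (p q : ℝ) (ht : t ∈ s) :
    pqTension D p q γ t = -((‖curvatureVector D γ t‖ ^ (q - 2) * c) • curvatureVector D γ t)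
      - covDerivAlong D γ (covDerivAlong D γ (pqField D p q γ)) t
      - (p - 2) • covDerivAlong D γ (pqFlux₂ D p q γ) t := by
  rw [pqTension, covDerivAlong_congr (eventually_of_mem (hs.mem_nhds ht) fun r hr =>
    pqFlux₁_eq hu p q hr), pTension_eq hs hu p ht, hu t ht,
    curvatureTensor_of_hasConstantCurvature hD hc, inner_curvatureVector_velocity hD hs hγ hu ht,
    hu t ht]
  simp only [Real.one_rpow, one_mul, one_pow, one_smul, zero_smul, sub_zero, smul_smul]

/-- Where the geodesic curvature `κ` does not vanish, its derivative does. The component of the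
`(p,q)`-harmonic equation along the velocity is `⟨∇_T V, ∇_T T⟩ + (p - 1) (κ ^ q)' = 0`, and the
first term is `(q - 1) κ ^ (q - 1) κ'`. -/
lemma deriv_inner_curvatureVector_self (hD : IsLeviCivita D) (hc : HasConstantCurvature D c)
    (hs : IsOpen s) (hγ : ContMDiffOn 𝓘(ℝ, ℝ) 𝓘(ℝ, E) ∞ γ s)
    (hu : ∀ t ∈ s, ‖velocity (E := E) γ t‖ = 1) {p q : ℝ} (hp : 1 < p) (hq : 1 < q)
    (h : IsPQHarmonicOn D p q γ s) (ht : t ∈ s) (h0 : curvatureVector D γ t ≠ 0) :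
    deriv (fun r => (inner ℝ (curvatureVector D γ r) (curvatureVector D γ r) : ℝ)) t = 0 := by
  have hWs : SmoothAlongOn (curvatureVector D γ) s := smoothAlongOn_curvatureVector hD hs hγ
  have hT := (smoothAlongOn_velocity hs hγ).diffAlongAt hs ht
  have hW := hWs.diffAlongAt hs ht
  set g : ℝ → ℝ := fun r => inner ℝ (curvatureVector D γ r) (curvatureVector D γ r) with hg
  set φ : ℝ → ℝ := fun r => ‖curvatureVector D γ r‖ ^ (q - 2) with hφ
  have hgt : 0 < g t := real_inner_self_pos.2 h0
  have hgd : HasDerivAt g (deriv g t) t := (hW.differentiableAt_inner hW).hasDerivAt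
  have hφg (r : ℝ) : φ r = g r ^ ((q - 2) / 2) := by
    rw [hφ, hg]
    simp only
    rw [real_inner_self_eq_norm_sq, ← Real.rpow_natCast, ← Real.rpow_mul (norm_nonneg _)]
    congr 1
    push_cast
    ring
  have hφd : HasDerivAt φ ((q - 2) / 2 * (φ t / g t) * deriv g t) t := by
    have h1 := hgd.rpow_const (p := (q - 2) / 2) (Or.inl hgt.ne')
    rw [Real.rpow_sub_one hgt.ne', ← hφg] at h1
    exact (h1.congr_of_eventuallyEq (Eventually.of_forall hφg)).congr_deriv (by ring)
  have hφt : 0 < φ t := Real.rpow_pos_of_pos (norm_pos_iff.2 h0) _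
  -- `φ * g = ‖∇_T T‖ ^ q` is, up to sign, the component of `∇_T V` along `T`.
  have had : HasDerivAt (fun r => -(φ r * g r)) (-(q / 2 * φ t * deriv g t)) t := by
    refine (hφd.mul hgd).neg.congr_deriv ?_
    field_simp
    ring
  have hWW : inner ℝ (covDerivAlong D γ (curvatureVector D γ) t) (curvatureVector D γ t) =
      deriv g t / 2 := by
    have h1 := hgd.unique (hasDerivAt_inner_along hD.metric hW hW)
    rw [real_inner_comm] at h1
    linarith [real_inner_comm (curvatureVector D γ t)
      (covDerivAlong D γ (curvatureVector D γ) t)]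
  have hVW : inner ℝ (covDerivAlong D γ (pqField D p q γ) t) (curvatureVector D γ t) =
      (q - 1) / 2 * φ t * deriv g t := by
    rw [covDerivAlong_congr (eventually_of_mem (hs.mem_nhds ht) fun r hr =>
      pqField_eq hs hu p q hr), covDerivAlong_smul hφd.differentiableAt hW, hφd.deriv,
      inner_add_left, real_inner_smul_left, real_inner_smul_left, hWW]
    change _ * g t + φ t * _ = _
    field_simp
    ring
  have hV1 : DiffAlongAt (covDerivAlong D γ (pqField D p q γ)) t :=
    (h t ht).2.1.congr (eventually_of_mem (hs.mem_nhds ht) fun r hr => (pqFlux₁_eq hu p q hr).symm)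
  have hgn (r : ℝ) : g r = ‖curvatureVector D γ r‖ ^ 2 := real_inner_self_eq_norm_sq _
  have hVT : inner ℝ (covDerivAlong D γ (covDerivAlong D γ (pqField D p q γ)) t)
      (velocity (E := E) γ t) = -(q / 2 * φ t * deriv g t) - (q - 1) / 2 * φ t * deriv g t := by
    have h1 := (hasDerivAt_inner_along hD.metric hV1 hT).unique
      (had.congr_of_eventuallyEq (eventually_of_mem (hs.mem_nhds ht) fun r hr => by
        simp only
        rw [(pqFlux₂_eq hD hs hγ hu hr (h r hr).1).1, hgn]))
    rw [← curvatureVector, hVW] at h1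
    linarith
  have hF : covDerivAlong D γ (pqFlux₂ D p q γ) t = (-(q / 2 * φ t * deriv g t)) • velocity γ t
      + (-(φ t * g t)) • curvatureVector D γ t := by
    rw [covDerivAlong_congr (W := fun r => (-(φ r * g r)) • velocity γ r)
      (eventually_of_mem (hs.mem_nhds ht) fun r hr => by
        rw [(pqFlux₂_eq hD hs hγ hu hr (h r hr).1).2, hgn]),
      covDerivAlong_smul had.differentiableAt hT, had.deriv]
    rfl
  have h1 : inner ℝ (pqTension D p q γ t) (velocity (E := E) γ t) = (0 : ℝ) := by
    rw [(h t ht).2.2.2, inner_zero_left]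
  rw [pqTension_eq hD hc hs hγ hu p q ht, hF, inner_sub_left, inner_sub_left, inner_neg_left,
    real_inner_smul_left, real_inner_smul_left, inner_add_left, real_inner_smul_left,
    real_inner_smul_left, hVT, inner_curvatureVector_velocity hD hs hγ hu ht,
    real_inner_self_eq_norm_sq, hu t ht] at h1
  have h2 : (φ t * ((q - 1) + (p - 1) * q)) * deriv g t = 0 := by linear_combination 2 * h1
  refine (mul_eq_zero.1 h2).resolve_left (mul_pos hφt ?_).ne'
  have := mul_pos (sub_pos.2 hp) (one_pos.trans hq)
  linarith

/-- A `(p,q)`-harmonic curve has constant geodesic curvature. -/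
theorem IsPQHarmonicOn.norm_curvatureVector_eq (hD : IsLeviCivita D)
    (hc : HasConstantCurvature D c) (hs : IsOpen s) (hs' : s.OrdConnected)
    (hγ : ContMDiffOn 𝓘(ℝ, ℝ) 𝓘(ℝ, E) ∞ γ s) (hu : ∀ t ∈ s, ‖velocity (E := E) γ t‖ = 1)
    {p q : ℝ} (hp : 1 < p) (hq : 1 < q) (h : IsPQHarmonicOn D p q γ s) {a b : ℝ} (ha : a ∈ s) (hb : b ∈ s) :
    ‖curvatureVector D γ a‖ = ‖curvatureVector D γ b‖ := by
  have hW : SmoothAlongOn (curvatureVector D γ) s := smoothAlongOn_curvatureVector hD hs hγ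
  have hd (t : ℝ) (ht : t ∈ s) :=
    (hW.diffAlongAt hs ht).differentiableAt_inner (hW.diffAlongAt hs ht)
  -- The derivative of the square of `‖∇_T T‖ ^ 2` vanishes also at the zeros of `∇_T T`.
  have h1 := hs.is_const_of_deriv_eq_zero hs'.isPreconnected
    (f := fun r => (inner ℝ (curvatureVector D γ r) (curvatureVector D γ r) : ℝ) ^ 2)
    (fun t ht => ((hd t ht).pow 2).differentiableWithinAt) (fun t ht => by
      by_cases h0 : curvatureVector D γ t = 0
      · rw [deriv_fun_pow (hd t ht), h0]
        simp
      · rw [deriv_fun_pow (hd t ht),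
          deriv_inner_curvatureVector_self hD hc hs hγ hu hp hq h ht h0, mul_zero]
        rfl) ha hb
  simp only [real_inner_self_eq_norm_sq] at h1
  exact (pow_left_inj₀ (norm_nonneg _) (norm_nonneg _) two_ne_zero).1
    ((pow_left_inj₀ (by positivity) (by positivity) two_ne_zero).1 h1)

/-- If the geodesic curvature is a positive constant, the `(p,q)`-harmonic equation is a linear
equation for the curvature vector. -/
theorem isPQHarmonicOn_iff (hD : IsLeviCivita D) (hc : HasConstantCurvature D c)
    (hs : IsOpen s) (hγ : ContMDiffOn 𝓘(ℝ, ℝ) 𝓘(ℝ, E) ∞ γ s)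
    (hu : ∀ t ∈ s, ‖velocity (E := E) γ t‖ = 1) (p q : ℝ) (hk : 0 < k)
    (hW : ∀ t ∈ s, ‖curvatureVector D γ t‖ = k) :
    IsPQHarmonicOn D p q γ s ↔
      ∀ t ∈ s, covDerivAlong D γ (covDerivAlong D γ (curvatureVector D γ)) t =
        ((p - 2) * k ^ 2 - c) • curvatureVector D γ t := by
  have hs₀ : SmoothAlongOn (curvatureVector D γ) s := smoothAlongOn_curvatureVector hD hs hγ
  have hs₁ := hs₀.covDerivAlong hD.smooth hs hγ
  have hT := smoothAlongOn_velocity hs hγ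
  have e0 (t) (ht : t ∈ s) : ∀ᶠ r in 𝓝 t, pqField D p q γ r = k ^ (q - 2) • curvatureVector D γ r :=
    eventually_of_mem (hs.mem_nhds ht) fun r hr => by rw [pqField_eq hs hu p q hr, hW r hr]
  have d0 (t) (ht : t ∈ s) : DiffAlongAt (pqField D p q γ) t :=
    ((hs₀.diffAlongAt hs ht).smul (differentiableAt_const _)).congr (e0 t ht)
  have e1 (t) (ht : t ∈ s) : ∀ᶠ r in 𝓝 t, covDerivAlong D γ (pqField D p q γ) r =
      k ^ (q - 2) • covDerivAlong D γ (curvatureVector D γ) r :=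
    eventually_of_mem (hs.mem_nhds ht) fun r hr => by
      rw [covDerivAlong_congr (e0 r hr), covDerivAlong_const_smul _ (hs₀.diffAlongAt hs hr)]
  have d1 (t) (ht : t ∈ s) : DiffAlongAt (pqFlux₁ D p q γ) t :=
    (((hs₁.diffAlongAt hs ht).smul (differentiableAt_const _)).congr (e1 t ht)).congr
      (eventually_of_mem (hs.mem_nhds ht) fun r hr => pqFlux₁_eq hu p q hr)
  have e2 (t) (ht : t ∈ s) : ∀ᶠ r in 𝓝 t, pqFlux₂ D p q γ r =
      (-(k ^ (q - 2) * k ^ 2)) • velocity γ r :=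
    eventually_of_mem (hs.mem_nhds ht) fun r hr => by
      rw [(pqFlux₂_eq hD hs hγ hu hr (d0 r hr)).2, hW r hr]
  have d2 (t) (ht : t ∈ s) : DiffAlongAt (pqFlux₂ D p q γ) t :=
    ((hT.diffAlongAt hs ht).smul (differentiableAt_const _)).congr (e2 t ht)
  have key (t) (ht : t ∈ s) : pqTension D p q γ t = k ^ (q - 2) •
      (((p - 2) * k ^ 2 - c) • curvatureVector D γ t -
        covDerivAlong D γ (covDerivAlong D γ (curvatureVector D γ)) t) := by
    rw [pqTension_eq hD hc hs hγ hu p q ht, covDerivAlong_congr (e1 t ht),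
      covDerivAlong_congr (e2 t ht), covDerivAlong_const_smul _ (hs₁.diffAlongAt hs ht),
      covDerivAlong_const_smul _ (hT.diffAlongAt hs ht), ← curvatureVector, hW t ht]
    module
  have hk' : k ^ (q - 2) ≠ 0 := (Real.rpow_pos_of_pos hk _).ne'
  refine forall₂_congr fun t ht => ?_
  simp only [d0 t ht, d1 t ht, d2 t ht, true_and, key t ht, smul_eq_zero, hk', false_or,
    sub_eq_zero]
  exact eq_comm

end Tension

/-! ### Frenet frames of constant curvature and torsion -/

section Frenet

variable {E : Type*} [NormedAddCommGroup E] [NormedSpace ℝ E]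
  {M : Type*} [TopologicalSpace M] [ChartedSpace E M] [IsManifold 𝓘(ℝ, E) ∞ M]
  [RiemannianBundle (fun x : M => TangentSpace 𝓘(ℝ, E) x)]
  {D : CovariantDerivative 𝓘(ℝ, E) E (TangentSpace 𝓘(ℝ, E) : M → Type _)}
  {γ : ℝ → M} {N B : ∀ t, TangentSpace 𝓘(ℝ, E) (γ t)} {s : Set ℝ} {t k τ : ℝ}

/-- Along a curve of constant curvature and torsion, `∇_T ∇_T` acts on the curvature vector
`∇_T T` as multiplication by `-(k² + τ²)`. -/
lemma IsFrenetFrameOn.covDerivAlong_covDerivAlong_curvatureVector (hs : IsOpen s)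
    (hγ : ContMDiffOn 𝓘(ℝ, ℝ) 𝓘(ℝ, E) ∞ γ s)
    (h : IsFrenetFrameOn D γ s N B (fun _ => k) (fun _ => τ)) (ht : t ∈ s) :
    covDerivAlong D γ (covDerivAlong D γ (curvatureVector D γ)) t =
      (-(k ^ 2 + τ ^ 2)) • curvatureVector D γ t := by
  have hT := smoothAlongOn_velocity hs hγ
  have h1 (r) (hr : r ∈ s) : covDerivAlong D γ (curvatureVector D γ) r =
      (-k ^ 2) • velocity γ r + (k * τ) • B r := by
    rw [covDerivAlong_congr (V := curvatureVector D γ)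
        (eventually_of_mem (hs.mem_nhds hr) h.deriv_tangent),
      covDerivAlong_const_smul _ (h.smooth_normal.diffAlongAt hs hr), h.deriv_normal r hr]
    module
  rw [covDerivAlong_congr (eventually_of_mem (hs.mem_nhds ht) h1),
    covDerivAlong_add ((hT.diffAlongAt hs ht).smul (differentiableAt_const _))
      ((h.smooth_binormal.diffAlongAt hs ht).smul (differentiableAt_const _)),
    covDerivAlong_const_smul _ (hT.diffAlongAt hs ht),
    covDerivAlong_const_smul _ (h.smooth_binormal.diffAlongAt hs ht), h.deriv_binormal t ht,
    curvatureVector, h.deriv_tangent t ht]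
  module

variable [FiniteDimensional ℝ E]
  [IsContMDiffRiemannianBundle 𝓘(ℝ, E) ∞ E (fun x : M => TangentSpace 𝓘(ℝ, E) x)]

/-- If `∇_T N` has no component normal to `T` and `N`, it does not determine a binormal, but the
field `B` of `exists_binormal` gives a Frenet frame of vanishing torsion. -/
lemma exists_isFrenetFrameOn_of_torsion_eq_zero (hE : Module.finrank ℝ E = 3)
    (hD : IsLeviCivita D) (hs : IsOpen s) (hs' : s.OrdConnected) (hne : s.Nonempty)
    (hγ : ContMDiffOn 𝓘(ℝ, ℝ) 𝓘(ℝ, E) ∞ γ s) (hN : SmoothAlongOn N s)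
    (horth : ∀ t ∈ s, Orthonormal ℝ ![velocity γ t, N t]) (hk : 0 < k)
    (hkN : ∀ t ∈ s, covDerivAlong D γ (velocity γ) t = k • N t)
    (hDN : ∀ t ∈ s, covDerivAlong D γ N t = -(k • velocity (E := E) γ t)) :
    ∃ B, IsFrenetFrameOn D γ s N B (fun _ => k) (fun _ => 0) := by
  have hT := smoothAlongOn_velocity hs hγ
  obtain ⟨B, hB, hTNB⟩ := exists_binormal hE hs hs' hne hγ hT hN horth
  refine ⟨B, hN, hB, hTNB, fun _ _ => hk, hkN, fun t ht => by rw [hDN t ht, zero_smul, add_zero],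
    fun t ht => ?_⟩
  have ho (r) (hr : r ∈ s) := orthonormal_triple_iff.1 (hTNB r hr)
  have hBt := hB.diffAlongAt hs ht
  have h1 := inner_covDerivAlong_add_eq_zero hD hs ht (hT.diffAlongAt hs ht) hBt
    fun r hr => (ho r hr).2.2.1
  have h2 := inner_covDerivAlong_add_eq_zero hD hs ht (hN.diffAlongAt hs ht) hBt
    fun r hr => (ho r hr).2.2.2
  have h3 := inner_covDerivAlong_add_eq_zero (k := 1) hD hs ht hBt hBt
    fun r hr => by rw [real_inner_self_eq_norm_sq, (ho r hr).2.1, one_pow]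
  rw [hkN t ht, real_inner_smul_left, (ho t ht).2.2.2, mul_zero, zero_add] at h1
  rw [hDN t ht, inner_neg_left, real_inner_smul_left, (ho t ht).2.2.1, mul_zero, neg_zero,
    zero_add] at h2
  have h4 : inner ℝ (B t) (covDerivAlong D γ B t) = (0 : ℝ) := by
    linarith [real_inner_comm (B t) (covDerivAlong D γ B t)]
  have h5 := eq_sum_of_orthonormal (F := TangentSpace 𝓘(ℝ, E) (γ t)) hE (hTNB t ht)
    (covDerivAlong D γ B t)
  rw [h1, h2, h4] at h5
  rw [h5]
  module

/-- A curve whose curvature vector has constant length `k > 0` and is an eigenvector of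
`∇_T ∇_T` has a Frenet frame of constant curvature and torsion. -/
lemma exists_isFrenetFrameOn [T2Space M] (hE : Module.finrank ℝ E = 3)
    (hD : IsLeviCivita D) (hs : IsOpen s) (hs' : s.OrdConnected) (hne : s.Nonempty)
    (hγ : ContMDiffOn 𝓘(ℝ, ℝ) 𝓘(ℝ, E) ∞ γ s) (hu : ∀ t ∈ s, ‖velocity (E := E) γ t‖ = 1)
    (hk : 0 < k) (hW : ∀ t ∈ s, ‖curvatureVector D γ t‖ = k) {a : ℝ}
    (ha : ∀ t ∈ s, covDerivAlong D γ (covDerivAlong D γ (curvatureVector D γ)) t =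
      a • curvatureVector D γ t) :
    ∃ τ N B, IsFrenetFrameOn D γ s N B (fun _ => k) (fun _ => τ) ∧ a = -(k ^ 2 + τ ^ 2) := by
  have hT := smoothAlongOn_velocity hs hγ
  have hWs : SmoothAlongOn (curvatureVector D γ) s := smoothAlongOn_curvatureVector hD hs hγ
  let N : ∀ t, TangentSpace 𝓘(ℝ, E) (γ t) := fun t => k⁻¹ • curvatureVector D γ t
  have hN : SmoothAlongOn N s := hWs.smul hs contDiffOn_const
  have hkN (t : ℝ) : covDerivAlong D γ (velocity γ) t = k • N t := by
    rw [smul_inv_smul₀ hk.ne', curvatureVector]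
  have hNn (t) (ht : t ∈ s) : ‖N t‖ = 1 := by
    rw [norm_smul, hW t ht, norm_inv, Real.norm_of_nonneg hk.le, inv_mul_cancel₀ hk.ne']
  have hNT (t) (ht : t ∈ s) : inner ℝ (N t) (velocity (E := E) γ t) = (0 : ℝ) := by
    rw [real_inner_smul_left, inner_curvatureVector_velocity hD hs hγ hu ht, mul_zero]
  have horth (t) (ht : t ∈ s) : Orthonormal ℝ ![velocity (E := E) γ t, N t] :=
    orthonormal_pair_iff.2 ⟨hu t ht, hNn t ht, by rw [real_inner_comm, hNT t ht]⟩
  have hN₁ := hN.covDerivAlong hD.smooth hs hγ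
  have hN₂ (t) (ht : t ∈ s) : covDerivAlong D γ (covDerivAlong D γ N) t = a • N t := by
    rw [covDerivAlong_congr (eventually_of_mem (hs.mem_nhds ht) fun r hr =>
      covDerivAlong_const_smul k⁻¹ (hWs.diffAlongAt hs hr)), covDerivAlong_const_smul _
      ((hWs.covDerivAlong hD.smooth hs hγ).diffAlongAt hs ht), ha t ht, smul_comm]
  have hN₁T (t) (ht : t ∈ s) : inner ℝ (covDerivAlong D γ N t) (velocity (E := E) γ t) = -k := by
    have h := inner_covDerivAlong_add_eq_zero hD hs ht (hN.diffAlongAt hs ht)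
      (hT.diffAlongAt hs ht) hNT
    rw [hkN, real_inner_smul_right, real_inner_self_eq_norm_sq, hNn t ht] at h
    linarith
  have hN₁N (t) (ht : t ∈ s) : inner ℝ (covDerivAlong D γ N t) (N t) = (0 : ℝ) := by
    have h := inner_covDerivAlong_add_eq_zero (k := 1) hD hs ht (hN.diffAlongAt hs ht)
      (hN.diffAlongAt hs ht) fun r hr => by rw [real_inner_self_eq_norm_sq, hNn r hr, one_pow]
    linarith [real_inner_comm (N t) (covDerivAlong D γ N t)]
  have hN₁N₁ (t) (ht : t ∈ s) :
      inner ℝ (covDerivAlong D γ N t) (covDerivAlong D γ N t) = -a := by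
    have h := inner_covDerivAlong_add_eq_zero hD hs ht (hN₁.diffAlongAt hs ht)
      (hN.diffAlongAt hs ht) hN₁N
    rw [hN₂ t ht, real_inner_smul_left, real_inner_self_eq_norm_sq, hNn t ht] at h
    linarith
  -- The normal component of `∇_T N`, which is to be `τ B`.
  let A : ∀ t, TangentSpace 𝓘(ℝ, E) (γ t) := fun t => covDerivAlong D γ N t + k • velocity γ t
  have hA : SmoothAlongOn A s := hN₁.add hs (hT.smul hs contDiffOn_const)
  have hAT (t) (ht : t ∈ s) : inner ℝ (velocity (E := E) γ t) (A t) = (0 : ℝ) := by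
    rw [real_inner_comm, inner_add_left, real_inner_smul_left, hN₁T t ht,
      real_inner_self_eq_norm_sq, hu t ht]
    ring
  have hAN (t) (ht : t ∈ s) : inner ℝ (N t) (A t) = (0 : ℝ) := by
    rw [inner_add_right, real_inner_smul_right, real_inner_comm, hN₁N t ht, hNT t ht]
    ring
  have hAA (t) (ht : t ∈ s) : ‖A t‖ ^ 2 = -a - k ^ 2 := by
    rw [← real_inner_self_eq_norm_sq]
    nth_rw 1 [show A t = covDerivAlong D γ N t + k • velocity γ t from rfl]
    rw [inner_add_left, real_inner_smul_left, hAT t ht, inner_add_right, real_inner_smul_right,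
      hN₁N₁ t ht, hN₁T t ht]
    ring
  have hA₁ (t) (ht : t ∈ s) : covDerivAlong D γ A t = (a + k ^ 2) • N t := by
    rw [covDerivAlong_add (hN₁.diffAlongAt hs ht)
      ((hT.diffAlongAt hs ht).smul (differentiableAt_const _)),
      covDerivAlong_const_smul _ (hT.diffAlongAt hs ht), hN₂ t ht, hkN]
    module
  have hDN (t : ℝ) : covDerivAlong D γ N t = -(k • velocity (E := E) γ t) + A t := by
    simp only [A]
    module
  obtain ⟨t₀, ht₀⟩ := hne
  have h0 : 0 ≤ -a - k ^ 2 := hAA t₀ ht₀ ▸ sq_nonneg _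
  have hτ : √(-a - k ^ 2) ^ 2 = -a - k ^ 2 := Real.sq_sqrt h0
  rcases h0.eq_or_lt with h0 | h0
  · have hA0 (t) (ht : t ∈ s) : A t = 0 := by
      have h := hAA t ht
      rw [← h0] at h
      simpa using h
    obtain ⟨B, hB⟩ := exists_isFrenetFrameOn_of_torsion_eq_zero hE hD hs hs' ⟨t₀, ht₀⟩ hγ hN horth
      hk (fun t _ => hkN t) fun t ht => by rw [hDN, hA0 t ht, add_zero]
    exact ⟨0, N, B, hB, by linarith⟩
  · set τ := √(-a - k ^ 2)
    have hτ0 : 0 < τ := Real.sqrt_pos.2 h0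
    refine ⟨τ, N, fun t => τ⁻¹ • A t, ⟨hN, hA.smul hs contDiffOn_const, fun t ht => ?_,
      fun _ _ => hk, fun t _ => hkN t, fun t ht => ?_, fun t ht => ?_⟩, by linarith⟩
    · refine orthonormal_triple_iff.2 ⟨horth t ht, ?_, ?_, ?_⟩
      · have h : ‖A t‖ = τ :=
          (pow_left_inj₀ (norm_nonneg _) hτ0.le two_ne_zero).1 ((hAA t ht).trans hτ.symm)
        rw [norm_smul, h, norm_inv, Real.norm_of_nonneg hτ0.le, inv_mul_cancel₀ hτ0.ne']
      · rw [real_inner_smul_right, hAT t ht, mul_zero]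
      · rw [real_inner_smul_right, hAN t ht, mul_zero]
    · rw [smul_inv_smul₀ hτ0.ne', hDN]
    · rw [covDerivAlong_const_smul _ (hA.diffAlongAt hs ht), hA₁ t ht,
        show a + k ^ 2 = -τ ^ 2 by linarith, smul_smul, ← neg_smul]
      congr 1
      field_simp

end Frenet

/-! ### Proper `(p,q)`-harmonic curves -/

theorem theorem4 {M : Type*} [TopologicalSpace M] [T2Space M]
    [ChartedSpace (EuclideanSpace ℝ (Fin 3)) M]
    [IsManifold 𝓘(ℝ, EuclideanSpace ℝ (Fin 3)) ∞ M]
    [RiemannianBundle (fun x : M => TangentSpace 𝓘(ℝ, EuclideanSpace ℝ (Fin 3)) x)]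
    [IsContMDiffRiemannianBundle 𝓘(ℝ, EuclideanSpace ℝ (Fin 3)) ∞ (EuclideanSpace ℝ (Fin 3))
      (fun x : M => TangentSpace 𝓘(ℝ, EuclideanSpace ℝ (Fin 3)) x)]
    (D : CovariantDerivative 𝓘(ℝ, EuclideanSpace ℝ (Fin 3)) (EuclideanSpace ℝ (Fin 3))
      (TangentSpace 𝓘(ℝ, EuclideanSpace ℝ (Fin 3)) : M → Type _))
    (hD : IsLeviCivita D)
    (c : ℝ) (hc : HasConstantCurvature D c)
    (p q : ℝ) (hp : 1 < p) (hq : 1 < q)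
    (s : Set ℝ) (hs_open : IsOpen s) (hs_interval : s.OrdConnected) (hs_nonempty : s.Nonempty)
    (γ : ℝ → M) (hγ : ContMDiffOn 𝓘(ℝ, ℝ) 𝓘(ℝ, EuclideanSpace ℝ (Fin 3)) ∞ γ s)
    (hγ_unit : ∀ t ∈ s, ‖velocity (E := EuclideanSpace ℝ (Fin 3)) γ t‖ = 1) :
    IsProperPQHarmonicOn D p q γ s ↔
      ∃ k τ : ℝ, 0 < k ∧
        (∃ N B : ∀ t, TangentSpace 𝓘(ℝ, EuclideanSpace ℝ (Fin 3)) (γ t),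
          IsFrenetFrameOn D γ s N B (fun _ => k) (fun _ => τ)) ∧
        p = (c - τ ^ 2) / k ^ 2 + 1 := by
  constructor
  · rintro ⟨h, hnot⟩
    simp only [IsPHarmonicOn, not_forall] at hnot
    obtain ⟨t₀, ht₀, h0⟩ := hnot
    rw [pTension_eq hs_open hγ_unit p ht₀] at h0
    have hk := norm_pos_iff.2 h0
    have hW (t) (ht : t ∈ s) := h.norm_curvatureVector_eq hD hc hs_open hs_interval hγ hγ_unit hp hq
      ht ht₀
    set k := ‖curvatureVector D γ t₀‖
    obtain ⟨τ, N, B, hF, hτ⟩ := exists_isFrenetFrameOn (by simp) hD hs_open hs_interval hs_nonempty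
      hγ hγ_unit hk hW ((isPQHarmonicOn_iff hD hc hs_open hγ hγ_unit p q hk hW).1 h)
    refine ⟨k, τ, hk, ⟨N, B, hF⟩, ?_⟩
    field_simp
    linarith
  · rintro ⟨k, τ, hk, ⟨N, B, hF⟩, hp'⟩
    have hN (t) (ht : t ∈ s) : ‖N t‖ = 1 := (hF.orthonormal t ht).1 1
    have hW (t) (ht : t ∈ s) : ‖curvatureVector D γ t‖ = k := by
      rw [curvatureVector, hF.deriv_tangent t ht, norm_smul, hN t ht, mul_one,
        Real.norm_of_nonneg hk.le]
    refine ⟨(isPQHarmonicOn_iff hD hc hs_open hγ hγ_unit p q hk hW).2 fun t ht => ?_, fun h => ?_⟩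
    · rw [hF.covDerivAlong_covDerivAlong_curvatureVector hs_open hγ ht]
      congr 1
      rw [hp']
      field_simp
      ring
    · obtain ⟨t₀, ht₀⟩ := hs_nonempty
      have h1 := hW t₀ ht₀
      rw [← pTension_eq hs_open hγ_unit p ht₀, h t₀ ht₀, norm_zero] at h1
      exact hk.ne h1
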